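/- Let $\Omega\subset\mathbb{R}^2$ be a bounded open set of class $C^{1,1}$, let $D\in W^{2,\infty}(\Omega)$, and let $g>0$, $b>0$, $c\ge 0$ be constants (for the Bona–Smith systems, $b=\frac{3\theta^2-1}{6}$ and $c=\frac{3\theta^2-2}{3}$ with $\frac23\le\theta^2\le1$). Let $T>0$, $\eta_0,\phi_0\in H^2(\Omega)$, and let $(\eta,\phi)\in C^1([0,T];H^2(\Omega)\times H^2(\Omega))$ be a solution, for all $t\in[0,T]$, of the potential formulation $$\eta_t+\nabla\cdot[(D+\eta)\nabla\phi]-b\,\nabla\cdot(D^2\nabla\eta_t)=0,$$ $$\phi_t+g\eta+\tfrac12|\nabla\phi|^2-cg\,\nabla\cdot(D^2\nabla\eta)-b\,\nabla\cdot(D^2\nabla\phi_t)=0\quad\text{in }\Omega,$$ with $\eta(\cdot,0)=\eta_0$, $\phi(\cdot,0)=\phi_0$ and the Neumann conditions $\nabla\eta\cdot\mathbf n=0$, $\nabla\phi\cdot\mathbf n=0$ on $\partial\Omega$. Here divergences and gradients are taken in the sense of distributions and the equations hold almost everywhere in $\Omega$; for a field $V\in L^2(\Omega)^2$, the condition $V\cdot\mathbf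 n=0$ on $\partial\Omega$ means that $\nabla\cdot V\in L^2(\Omega)$ and $\int_\Omega (\nabla\cdot V)\,w+V\cdot\nabla w\,dx=0$ for all $w\in H^1(\Omega)$ (vanishing normal trace). Then: 1. For every $t\in[0,T]$ the energy density below is integrable over $\Omega$, the energy is differentiable in $t$ (one-sidedly at $t=0,T$), and $$\frac{d}{dt}\,\frac12\int_\Omega\big[g\eta^2+(D+\eta)|\nabla\phi|^2+cgD^2|\nabla\eta|^2\big]\,dx=0.$$ 2. This coincides with the conservation of energy of the original Bona–Smith system: with $\mathbf u=\nabla\phi$, the pair $(\eta,\mathbf u)\in C^1([0,T];H^2(\Omega)\times H^1(\Omega)^2)$ solves $$\eta_t+\nabla\cdot[(D+\eta)\mathbf u]-b\,\nabla\cdot(D^2\nabla\eta_t)=0,$$ $$\mathbf u_t+g\nabla\eta+\tfrac12\nabla|\mathbf u|^2-\nabla\{cg\,\nabla\cdot(D^2\nabla\eta)+b\,\nabla\cdot(D^2\mathbf u_t)\}=0\quad\text{in }\Omega,$$ in the same sense, with $\eta(\cdot,0)=\eta_0$, $\mathbf u(\cdot,0)=\nabla\phi_0$ and the slip-wall conditions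 $\nabla\eta\cdot\mathbf n=0$, $\mathbf u\cdot\mathbf n=0$ on $\partial\Omega$. For all $t\in[0,T]$ its energy $$\mathcal E(t;\eta,\mathbf u)=\frac12\int_\Omega g\eta^2+(D+\eta)|\mathbf u|^2+cgD^2|\nabla\eta|^2\,dx$$ equals the energy in 1, and $\frac{d}{dt}\mathcal E(t;\eta,\mathbf u)=0$. -/

import Mathlib

open MeasureTheory Set
open scoped ENNReal NNReal ContDiff

noncomputable section

namespace BonaSmith

/-- The Euclidean plane. -/
abbrev Plane : Type := EuclideanSpace ℝ (Fin 2)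

/-- The classical partial derivative `∂ψ/∂xᵢ`. -/
def pd (i : Fin 2) (ψ : Plane → ℝ) (x : Plane) : ℝ :=
  fderiv ℝ ψ x (EuclideanSpace.single i (1 : ℝ))

/-- Test functions: smooth with compact support contained in `Ω`. -/
structure IsTest (Ω : Set Plane) (ψ : Plane → ℝ) : Prop where
  smooth : ContDiff ℝ ∞ ψ
  compact : HasCompactSupport ψ
  supp : tsupport ψ ⊆ Ω

/-- `g` is the weak (distributional) partial derivative `∂f/∂xᵢ` in `Ω`. -/
structure HasWeakPartial (Ω : Set Plane) (i : Fin 2) (f g : Plane → ℝ) : Prop where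
  locInt : LocallyIntegrableOn f Ω
  locInt' : LocallyIntegrableOn g Ω
  eq : ∀ ψ, IsTest Ω ψ → ∫ x in Ω, f x * pd i ψ x = -∫ x in Ω, g x * ψ x

/-- `m` is the weak (distributional) divergence `∇·V` in `Ω`. -/
structure HasWeakDiv (Ω : Set Plane) (V : Fin 2 → Plane → ℝ) (m : Plane → ℝ) : Prop where
  locInt : ∀ i, LocallyIntegrableOn (V i) Ω
  locInt' : LocallyIntegrableOn m Ω
  eq : ∀ ψ, IsTest Ω ψ → ∫ x in Ω, ∑ i, V i x * pd i ψ x = -∫ x in Ω, m x * ψ x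

/-- An open set with boundary of class `C^{1,1}`: near each boundary point, in suitable orthonormal
coordinates, `Ω` is the region above the graph of a differentiable function with Lipschitz
derivative. -/
def IsC11 (Ω : Set Plane) : Prop :=
  IsOpen Ω ∧ ∀ p ∈ frontier Ω, ∃ (L : Plane ≃ₗᵢ[ℝ] Plane) (f : ℝ → ℝ) (K : ℝ≥0) (r : ℝ),
    0 < r ∧ Differentiable ℝ f ∧ LipschitzWith K (deriv f) ∧
      ∀ y ∈ Metric.ball p r, y ∈ Ω ↔ f (L y 0) < L y 1

/-- `f` belongs to the Sobolev space `W^{2,∞}(Ω)`. -/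
def MemW2Inf (Ω : Set Plane) (f : Plane → ℝ) : Prop :=
  MemLp f ∞ (volume.restrict Ω) ∧
    ∃ (p : Fin 2 → Plane → ℝ) (q : Fin 2 → Fin 2 → Plane → ℝ),
      (∀ i, MemLp (p i) ∞ (volume.restrict Ω) ∧ HasWeakPartial Ω i f (p i)) ∧
      ∀ i j, MemLp (q i j) ∞ (volume.restrict Ω) ∧ HasWeakPartial Ω j (p i) (q i j)

/-- `L²(Ω)`. -/
abbrev L2 (Ω : Set Plane) : Type := Lp ℝ 2 (volume.restrict Ω)

theorem L2.locInt {Ω : Set Plane} (f : L2 Ω) : LocallyIntegrableOn f Ω :=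
  locallyIntegrableOn_of_locallyIntegrable_restrict ((Lp.memLp f).locallyIntegrable (by norm_num))

theorem IsTest.integrable_mul {Ω : Set Plane} {ψ : Plane → ℝ} (h : IsTest Ω ψ) (f : L2 Ω) :
    Integrable (fun x => f x * ψ x) (volume.restrict Ω) := by
  have h2 : MemLp ψ 2 (volume.restrict Ω) :=
    (h.smooth.continuous.memLp_of_hasCompactSupport h.compact).restrict Ω
  exact (Lp.memLp f).integrable_mul h2

theorem IsTest.pd {Ω : Set Plane} {ψ : Plane → ℝ} (h : IsTest Ω ψ) (i : Fin 2) :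
    IsTest Ω (pd i ψ) where
  smooth := (h.smooth.fderiv_right (m := ∞) (by simp)).clm_apply contDiff_const
  compact := h.compact.fderiv_apply ℝ _
  supp := (tsupport_fderiv_apply_subset ℝ _).trans h.supp

/-- On `L²(Ω)` a weak partial derivative is determined by the integration by parts identity. -/
theorem HasWeakPartial.iff_L2 {Ω : Set Plane} {i : Fin 2} {f g : L2 Ω} :
    HasWeakPartial Ω i f g ↔
      ∀ ψ, IsTest Ω ψ → ∫ x in Ω, f x * BonaSmith.pd i ψ x = -∫ x in Ω, g x * ψ x :=
  ⟨fun h => h.eq, fun h => ⟨f.locInt, g.locInt, h⟩⟩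

theorem integral_add_mul {Ω : Set Plane} {ψ : Plane → ℝ} (h : IsTest Ω ψ) (f g : L2 Ω) :
    ∫ x in Ω, (f + g : L2 Ω) x * ψ x = (∫ x in Ω, f x * ψ x) + ∫ x in Ω, g x * ψ x := by
  rw [← integral_add (h.integrable_mul f) (h.integrable_mul g)]
  refine integral_congr_ae ?_
  filter_upwards [Lp.coeFn_add f g] with x hx
  rw [hx, Pi.add_apply, add_mul]

theorem integral_smul_mul {Ω : Set Plane} (ψ : Plane → ℝ) (a : ℝ) (f : L2 Ω) :
    ∫ x in Ω, (a • f : L2 Ω) x * ψ x = a * ∫ x in Ω, f x * ψ x := by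
  rw [← integral_const_mul]
  refine integral_congr_ae ?_
  filter_upwards [Lp.coeFn_smul a f] with x hx
  simp [hx, mul_assoc]

theorem integral_zero_mul {Ω : Set Plane} (ψ : Plane → ℝ) :
    ∫ x in Ω, (0 : L2 Ω) x * ψ x = 0 := by
  simpa using integral_smul_mul ψ 0 (0 : L2 Ω)

theorem HasWeakPartial.zero {Ω : Set Plane} {i : Fin 2} :
    HasWeakPartial Ω i (0 : L2 Ω) (0 : L2 Ω) :=
  iff_L2.2 fun ψ _ => by rw [integral_zero_mul, integral_zero_mul, neg_zero]

theorem HasWeakPartial.add {Ω : Set Plane} {i : Fin 2} {f g f' g' : L2 Ω}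
    (h : HasWeakPartial Ω i f g) (h' : HasWeakPartial Ω i f' g') :
    HasWeakPartial Ω i (f + f' : L2 Ω) (g + g' : L2 Ω) :=
  iff_L2.2 fun ψ hψ => by
    rw [integral_add_mul (hψ.pd i), integral_add_mul hψ, h.eq ψ hψ, h'.eq ψ hψ, neg_add]

theorem HasWeakPartial.smul {Ω : Set Plane} {i : Fin 2} {f g : L2 Ω} (a : ℝ)
    (h : HasWeakPartial Ω i f g) : HasWeakPartial Ω i (a • f : L2 Ω) (a • g : L2 Ω) :=
  iff_L2.2 fun ψ hψ => by
    rw [integral_smul_mul, integral_smul_mul, h.eq ψ hψ, mul_neg]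

/-- The Sobolev space `H¹(Ω)`: tuples `(u, ∇u)` in `L²(Ω)`, with the (equivalent) norm
`max (‖u‖, ‖∂ᵢu‖)`. -/
def sobolevH1 (Ω : Set Plane) : Submodule ℝ (L2 Ω × (Fin 2 → L2 Ω)) where
  carrier := {u | ∀ i, HasWeakPartial Ω i u.1 (u.2 i)}
  add_mem' := fun hu hv i => (hu i).add (hv i)
  zero_mem' := fun _ => HasWeakPartial.zero
  smul_mem' := fun a _ hu i => (hu i).smul a

/-- The Sobolev space `H²(Ω)`: tuples `(u, ∇u, ∇²u)` in `L²(Ω)`, with the (equivalent) norm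
`max (‖u‖, ‖∂ᵢu‖, ‖∂ⱼ∂ᵢu‖)`. -/
def sobolevH2 (Ω : Set Plane) :
    Submodule ℝ (L2 Ω × (Fin 2 → L2 Ω) × (Fin 2 → Fin 2 → L2 Ω)) where
  carrier := {u | (∀ i, HasWeakPartial Ω i u.1 (u.2.1 i)) ∧
    ∀ i j, HasWeakPartial Ω j (u.2.1 i) (u.2.2 i j)}
  add_mem' := fun hu hv => ⟨fun i => (hu.1 i).add (hv.1 i), fun i j => (hu.2 i j).add (hv.2 i j)⟩
  zero_mem' := ⟨fun _ => HasWeakPartial.zero, fun _ _ => HasWeakPartial.zero⟩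
  smul_mem' := fun a _ hu => ⟨fun i => (hu.1 i).smul a, fun i j => (hu.2 i j).smul a⟩

/-- The Sobolev space `H¹(Ω)`. -/
abbrev H1 (Ω : Set Plane) : Type := sobolevH1 Ω

/-- The Sobolev space `H²(Ω)`. -/
abbrev H2 (Ω : Set Plane) : Type := sobolevH2 Ω

/-- The function underlying `u ∈ H¹(Ω)`. -/
def H1.fn {Ω : Set Plane} (u : H1 Ω) : Plane → ℝ := u.1.1

/-- The weak partial derivative `∂ᵢu` of `u ∈ H¹(Ω)`. -/
def H1.d {Ω : Set Plane} (u : H1 Ω) (i : Fin 2) : Plane → ℝ := u.1.2 i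

/-- The function underlying `u ∈ H²(Ω)`. -/
def H2.fn {Ω : Set Plane} (u : H2 Ω) : Plane → ℝ := u.1.1

/-- The weak partial derivative `∂ᵢu` of `u ∈ H²(Ω)`. -/
def H2.d {Ω : Set Plane} (u : H2 Ω) (i : Fin 2) : Plane → ℝ := u.1.2.1 i

/-- The weak gradient `∇u ∈ H¹(Ω)²` of `u ∈ H²(Ω)`. -/
def H2.grad {Ω : Set Plane} (u : H2 Ω) (i : Fin 2) : H1 Ω :=
  ⟨(u.1.2.1 i, u.1.2.2 i), u.2.2 i⟩

/-- `V·n = 0` on `∂Ω`: the field `V` lies in `H(div; Ω)` and its normal trace, the functional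
`w ↦ ∫_Ω (∇·V) w + V·∇w` on (traces of) functions `w ∈ H¹(Ω)`, vanishes. -/
def ZeroNormalTrace (Ω : Set Plane) (V : Fin 2 → Plane → ℝ) : Prop :=
  (∀ i, MemLp (V i) 2 (volume.restrict Ω)) ∧
    ∃ m : Plane → ℝ, MemLp m 2 (volume.restrict Ω) ∧ HasWeakDiv Ω V m ∧
      ∀ w : H1 Ω, ∫ x in Ω, (m x * w.fn x + ∑ i, V i x * w.d i x) = 0

/-- `(η, φ) ∈ C¹([0,T]; H²(Ω) × H²(Ω))` is a solution on `[0,T]` of the potential formulation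
  `η_t + ∇·[(D+η)∇φ] - b∇·(D²∇η_t) = 0`,
  `φ_t + gη + ½|∇φ|² - cg∇·(D²∇η) - b∇·(D²∇φ_t) = 0` in `Ω`,
with `η(0) = η₀`, `φ(0) = φ₀` and `∇η·n = ∇φ·n = 0` on `∂Ω`.
The time derivatives `η_t`, `φ_t` are those of the curves in `H²(Ω)`, and the divergences are taken
in the weak sense. -/
structure IsPotentialSolution (Ω : Set Plane) (D : Plane → ℝ) (g b c T : ℝ) (η₀ φ₀ : H2 Ω)
    (η φ : ℝ → H2 Ω) : Prop where
  regη : ContDiffOn ℝ 1 η (Icc 0 T)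
  regφ : ContDiffOn ℝ 1 φ (Icc 0 T)
  mass : ∀ t ∈ Icc 0 T, ∃ m n : Plane → ℝ,
    HasWeakDiv Ω (fun i x => (D x + (η t).fn x) * (φ t).d i x) m ∧
    HasWeakDiv Ω (fun i x => D x ^ 2 * (derivWithin η (Icc 0 T) t).d i x) n ∧
    ∀ᵐ x ∂volume.restrict Ω, (derivWithin η (Icc 0 T) t).fn x + m x - b * n x = 0
  momentum : ∀ t ∈ Icc 0 T, ∃ m n : Plane → ℝ,
    HasWeakDiv Ω (fun i x => D x ^ 2 * (η t).d i x) m ∧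
    HasWeakDiv Ω (fun i x => D x ^ 2 * (derivWithin φ (Icc 0 T) t).d i x) n ∧
    ∀ᵐ x ∂volume.restrict Ω,
      (derivWithin φ (Icc 0 T) t).fn x + g * (η t).fn x + 1 / 2 * ∑ i, (φ t).d i x ^ 2
        - c * g * m x - b * n x = 0
  initη : η 0 = η₀
  initφ : φ 0 = φ₀
  bcη : ∀ t ∈ Icc 0 T, ZeroNormalTrace Ω (η t).d
  bcφ : ∀ t ∈ Icc 0 T, ZeroNormalTrace Ω (φ t).d

/-- `(η, u) ∈ C¹([0,T]; H²(Ω) × H¹(Ω)²)` is a solution on `[0,T]` of the Bona–Smith system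
  `η_t + ∇·[(D+η)u] - b∇·(D²∇η_t) = 0`,
  `u_t + g∇η + ½∇|u|² - ∇{cg∇·(D²∇η) + b∇·(D²u_t)} = 0` in `Ω`,
with `η(0) = η₀`, `u(0) = u₀` and `∇η·n = u·n = 0` on `∂Ω`. -/
structure IsVelocitySolution (Ω : Set Plane) (D : Plane → ℝ) (g b c T : ℝ) (η₀ : H2 Ω)
    (u₀ : Fin 2 → H1 Ω) (η : ℝ → H2 Ω) (u : ℝ → Fin 2 → H1 Ω) : Prop where
  regη : ContDiffOn ℝ 1 η (Icc 0 T)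
  regu : ContDiffOn ℝ 1 u (Icc 0 T)
  mass : ∀ t ∈ Icc 0 T, ∃ m n : Plane → ℝ,
    HasWeakDiv Ω (fun i x => (D x + (η t).fn x) * (u t i).fn x) m ∧
    HasWeakDiv Ω (fun i x => D x ^ 2 * (derivWithin η (Icc 0 T) t).d i x) n ∧
    ∀ᵐ x ∂volume.restrict Ω, (derivWithin η (Icc 0 T) t).fn x + m x - b * n x = 0
  momentum : ∀ t ∈ Icc 0 T, ∃ (m n : Plane → ℝ) (k l : Fin 2 → Plane → ℝ),
    HasWeakDiv Ω (fun i x => D x ^ 2 * (η t).d i x) m ∧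
    HasWeakDiv Ω (fun i x => D x ^ 2 * (derivWithin u (Icc 0 T) t i).fn x) n ∧
    ∀ i, HasWeakPartial Ω i (fun x => ∑ j, (u t j).fn x ^ 2) (k i) ∧
      HasWeakPartial Ω i (fun x => c * g * m x + b * n x) (l i) ∧
      ∀ᵐ x ∂volume.restrict Ω,
        (derivWithin u (Icc 0 T) t i).fn x + g * (η t).d i x + 1 / 2 * k i x - l i x = 0
  initη : η 0 = η₀
  initu : u 0 = u₀
  bcη : ∀ t ∈ Icc 0 T, ZeroNormalTrace Ω (η t).d
  bcu : ∀ t ∈ Icc 0 T, ZeroNormalTrace Ω (fun i => (u t i).fn)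

/-- The energy density `gη² + (D+η)|∇φ|² + cgD²|∇η|²`. -/
def potentialDensity {Ω : Set Plane} (D : Plane → ℝ) (g c : ℝ) (η φ : H2 Ω) (x : Plane) : ℝ :=
  g * η.fn x ^ 2 + (D x + η.fn x) * ∑ i, φ.d i x ^ 2 + c * g * D x ^ 2 * ∑ i, η.d i x ^ 2

/-- The energy `½ ∫_Ω gη² + (D+η)|∇φ|² + cgD²|∇η|²` of the potential formulation. -/
def potentialEnergy {Ω : Set Plane} (D : Plane → ℝ) (g c : ℝ) (η φ : H2 Ω) : ℝ :=
  1 / 2 * ∫ x in Ω, potentialDensity D g c η φ x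

/-- The energy `½ ∫_Ω gη² + (D+η)|u|² + cgD²|∇η|²` of the Bona–Smith system. -/
def velocityEnergy {Ω : Set Plane} (D : Plane → ℝ) (g c : ℝ) (η : H2 Ω) (u : Fin 2 → H1 Ω) : ℝ :=
  1 / 2 * ∫ x in Ω, (g * η.fn x ^ 2 + (D x + η.fn x) * ∑ i, (u i).fn x ^ 2
    + c * g * D x ^ 2 * ∑ i, η.d i x ^ 2)

end BonaSmith

end

/-! ### Mollification and the chain rule for weak derivatives. -/

namespace BonaSmith

open Filter Topology
open scoped Convolution
open ContinuousLinearMap (lsmul)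

/-! Write `A u = ∇·(D²∇u)`, `M = ∇·[(D+η)∇φ]` and `Q = |∇φ|²`. The equations say `M = b A η_t - η_t`
and `Q = 2(b A φ_t + cg A η - gη - φ_t)`. Formally the kinetic part `∫ (D+η)|∇φ|²` has derivative
`-2⟨M, φ_t⟩ + ⟨η_t, Q⟩`. Substituting both formulas, the zeroth-order terms cancel against the
derivative of `g∫η²`, the `cg` terms cancel by Green's formula, and the remainder `-b⟨A η_t, φ_t⟩ +
b⟨η_t, A φ_t⟩` vanishes because `A` is symmetric under Neumann conditions.

The difficulty is that the kinetic part is cubic, while the natural spaces here are `L²`. The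
equations supply what is missing: `A` is bounded from `H²` to `L²`, so both `M` and `Q` are curves
in `L²`, continuous in time (`sqVelocity_ae`, `continuousOn_sqVelocity`, `continuousOn_massDiv`). In
particular `(D+η)|∇φ|²` is a product of two `L²` functions.

The derivative of the kinetic part is taken from an exact identity for its increment
(`kinetic_sub`): two terms are integrated by parts against `φ(s) - φ(t)`, and the third pairs `η(s)
- η(t)` with `∇φ(s)·∇φ(t)`. The latter product stays bounded in `L²` and converges weakly, which is
enough against the strongly convergent difference quotient of `η`
(`tendsto_inner_of_tendsto_bounded`).

Integration by parts for `(D+η)∇φ` is reduced to the vanishing normal trace of `∇φ` by testing with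
truncations of the product of `D+η` and the test function (`mul_integral_eq_zero`). This rests on a
chain rule and an `L²` product rule for weak derivatives, proved by mollification and truncation. -/

theorem tendsto_lintegral_translation_sub {f : Plane → ℝ} (hf : Integrable f) :
    Tendsto (fun z : Plane => ∫⁻ x, ‖f (x - z) - f x‖ₑ) (𝓝 0) (𝓝 0) := by
  have hf1 : MemLp f 1 := memLp_one_iff_integrable.2 hf
  let G : C(Plane × Plane, Plane) := ⟨fun a => a.2 - a.1, by fun_prop⟩
  have hG : ∀ z, MeasurePreserving (G.curry z) (volume : Measure Plane) volume := fun z =>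
    measurePreserving_sub_right volume z
  have h := Filter.Tendsto.compMeasurePreservingLp (p := 1) (μ := (volume : Measure Plane))
    (l := 𝓝 (0 : Plane)) (f := fun _ => hf1.toLp f) (f₀ := hf1.toLp f) (g := fun z => G.curry z)
    (g₀ := G.curry 0) tendsto_const_nhds (G.curry.continuous.tendsto 0) hG (hG 0) (by simp)
  rw [tendsto_iff_edist_tendsto_0] at h
  refine h.congr fun z => ?_
  rw [Lp.toLp_compMeasurePreserving, Lp.toLp_compMeasurePreserving, Lp.edist_toLp_toLp,
    eLpNorm_one_eq_lintegral_enorm]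
  simp [G]

/-- The error is an average, with weight of total mass one, of the translation errors `f(x - t) -
f(x)`. Tonelli bounds its `L¹` norm by the largest translation error with `|t| < rOut`. -/
theorem tendsto_lintegral_convolution_sub {f : Plane → ℝ} (hf : Integrable f)
    {φ : ℕ → ContDiffBump (0 : Plane)} (hφ : Tendsto (fun n => (φ n).rOut) atTop (𝓝 0)) :
    Tendsto (fun n => ∫⁻ x, ‖((φ n).normed volume ⋆[lsmul ℝ ℝ] f) x - f x‖ₑ) atTop (𝓝 0) := by
  rw [ENNReal.tendsto_nhds_zero]
  intro ε hε
  have h := (ENNReal.tendsto_nhds_zero.1 (tendsto_lintegral_translation_sub hf)) ε hε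
  obtain ⟨δ, hδ, hball⟩ := Metric.eventually_nhds_iff_ball.1 h
  filter_upwards [hφ.eventually (gt_mem_nhds hδ)] with n hn
  set ρ := (φ n).normed (volume : Measure Plane) with hρ
  have hρc : Continuous ρ := (φ n).continuous_normed
  have hpt : ∀ x, ‖(ρ ⋆[lsmul ℝ ℝ] f) x - f x‖ₑ ≤ ∫⁻ t, ‖ρ t‖ₑ * ‖f (x - t) - f x‖ₑ := by
    intro x
    have h1 : f x = ∫ t, ρ t * f x := by
      rw [integral_mul_const, (φ n).integral_normed, one_mul]
    have h2 : Integrable fun t => ρ t * f (x - t) :=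
      (φ n).hasCompactSupport_normed.convolutionExists_left (lsmul ℝ ℝ) hρc
        hf.locallyIntegrable x
    have h3 : (ρ ⋆[lsmul ℝ ℝ] f) x - f x = ∫ t, ρ t * (f (x - t) - f x) := by
      simp only [mul_sub]
      rw [integral_sub h2 ((φ n).integrable_normed.mul_const _), ← h1]
      rfl
    rw [h3]
    refine (enorm_integral_le_lintegral_enorm _).trans (le_of_eq ?_)
    simp only [enorm_mul]
  calc ∫⁻ x, ‖(ρ ⋆[lsmul ℝ ℝ] f) x - f x‖ₑ
      ≤ ∫⁻ x, ∫⁻ t, ‖ρ t‖ₑ * ‖f (x - t) - f x‖ₑ := lintegral_mono hpt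
    _ = ∫⁻ t, ∫⁻ x, ‖ρ t‖ₑ * ‖f (x - t) - f x‖ₑ := by
        refine lintegral_lintegral_swap ?_
        have hq : Measure.QuasiMeasurePreserving (fun p : Plane × Plane => p.1 - p.2)
            (volume.prod volume) volume := quasiMeasurePreserving_sub_of_right_invariant _ _
        have ha : AEMeasurable (fun p : Plane × Plane => f (p.1 - p.2)) (volume.prod volume) :=
          hf.aemeasurable.comp_quasiMeasurePreserving hq
        have hb : AEMeasurable (fun p : Plane × Plane => f p.1) (volume.prod volume) :=
          hf.aemeasurable.comp_quasiMeasurePreserving Measure.quasiMeasurePreserving_fst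
        exact (hρc.measurable.comp measurable_snd).aemeasurable.enorm.mul (ha.sub hb).enorm
    _ = ∫⁻ t, ‖ρ t‖ₑ * ∫⁻ x, ‖f (x - t) - f x‖ₑ := by
        refine lintegral_congr fun t => lintegral_const_mul' _ _ (by simp)
    _ ≤ ∫⁻ t, ‖ρ t‖ₑ * ε := by
        refine lintegral_mono fun t => ?_
        by_cases ht : t ∈ Metric.ball (0 : Plane) (φ n).rOut
        · exact mul_le_mul_right (hball t (Metric.ball_subset_ball hn.le ht)) _
        · have : ρ t = 0 := by
            by_contra h0
            exact ht ((φ n).support_normed_eq (μ := volume) ▸ h0)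
          simp [this]
    _ = ε := by
        rw [lintegral_mul_const _ (hρc.measurable.enorm),
          ← ofReal_integral_norm_eq_lintegral_enorm (φ n).integrable_normed]
        have : ∀ t, ‖(φ n).normed volume t‖ = (φ n).normed volume t := fun t =>
          Real.norm_of_nonneg ((φ n).nonneg_normed t)
        simp only [this, (φ n).integral_normed, ENNReal.ofReal_one, one_mul]

/-- For `x` at distance more than the mollification radius from the outside of `K`, the reflected
kernel `y ↦ ρ(x - y)` is itself a test function, and the weak derivative identity for it is the
claim. Cutting off to `K` makes the functions globally integrable without affecting the convolution
at such `x`. -/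
theorem pd_convolution_normed {Ω : Set Plane} {i : Fin 2} {p p' : Plane → ℝ}
    (h : HasWeakPartial Ω i p p') (φ : ContDiffBump (0 : Plane)) {K : Set Plane}
    (hK : IsCompact K) (hKΩ : K ⊆ Ω) {x : Plane} (hx : Metric.closedBall x φ.rOut ⊆ K) :
    pd i (φ.normed volume ⋆[lsmul ℝ ℝ] K.indicator p) x =
      (φ.normed volume ⋆[lsmul ℝ ℝ] K.indicator p') x := by
  have hKm := hK.measurableSet
  have hp : Integrable (K.indicator p) :=
    (integrable_indicator_iff hKm).2 (h.locInt.integrableOn_compact_subset hKΩ hK)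
  set ρ := φ.normed (volume : Measure Plane) with hρ
  have hρs : ContDiff ℝ ∞ ρ := φ.contDiff_normed
  have hρc : HasCompactSupport ρ := φ.hasCompactSupport_normed
  have hρ1 : ContDiff ℝ 1 ρ := φ.contDiff_normed
  set e : Plane := EuclideanSpace.single i (1 : ℝ) with he
  have hψs : Function.support (fun y => ρ (x - y)) ⊆ Metric.closedBall x φ.rOut := by
    intro y hy
    have : x - y ∈ Metric.ball (0 : Plane) φ.rOut := φ.support_normed_eq (μ := volume) ▸ hy
    rw [mem_ball_zero_iff, ← dist_eq_norm, dist_comm] at this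
    exact this.le
  have hψt : tsupport (fun y => ρ (x - y)) ⊆ Metric.closedBall x φ.rOut :=
    closure_minimal hψs Metric.isClosed_closedBall
  have hψ : IsTest Ω (fun y => ρ (x - y)) :=
    { smooth := hρs.comp (contDiff_const.sub contDiff_id)
      compact := (isCompact_closedBall x φ.rOut).of_isClosed_subset (isClosed_tsupport _) hψt
      supp := hψt.trans (hx.trans hKΩ) }
  have hpd : ∀ y, pd i (fun y => ρ (x - y)) y = -(fderiv ℝ ρ (x - y) e) := by
    intro y
    have h1 : HasFDerivAt (fun y => ρ (x - y)) _ y :=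
      ((hρ1.differentiable (by simp) (x - y)).hasFDerivAt).comp y ((hasFDerivAt_id y).const_sub x)
    rw [pd, h1.fderiv]
    simp [he]
  have hfd := hρc.hasFDerivAt_convolution_left (lsmul ℝ ℝ) hρ1 hp.locallyIntegrable x
  have hL : pd i (ρ ⋆[lsmul ℝ ℝ] K.indicator p) x = ∫ t, fderiv ℝ ρ (x - t) e * K.indicator p t := by
    rw [pd, hfd.fderiv, convolution_eq_swap, ContinuousLinearMap.integral_apply]
    · rfl
    · have := (hρc.fderiv ℝ).convolutionExists_left ((lsmul ℝ ℝ).precompL Plane)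
        (hρ1.continuous_fderiv (by simp)) hp.locallyIntegrable x
      exact this.integrable_swap
  have hR : (ρ ⋆[lsmul ℝ ℝ] K.indicator p') x = ∫ t, K.indicator p' t * ρ (x - t) := by
    rw [convolution_eq_swap]
    exact integral_congr_ae (Eventually.of_forall fun t => mul_comm _ _)
  have hind : ∀ u v : Plane → ℝ, (∀ y, y ∉ K → v y = 0) →
      ∫ t, K.indicator u t * v t = ∫ t in Ω, u t * v t := by
    intro u v hv
    have h0 : ∀ t, K.indicator u t * v t = u t * v t := by
      intro t
      by_cases ht : t ∈ K
      · rw [indicator_of_mem ht]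
      · rw [hv t ht, mul_zero, mul_zero]
    rw [integral_congr_ae (Eventually.of_forall h0), setIntegral_eq_integral_of_forall_compl_eq_zero]
    intro t ht
    rw [hv t fun hk => ht (hKΩ hk), mul_zero]
  have hv1 : ∀ y, y ∉ K → ρ (x - y) = 0 := fun y hy => by
    by_contra h0
    exact hy (hx (hψs h0))
  have hv2 : ∀ y, y ∉ K → pd i (fun y => ρ (x - y)) y = 0 := fun y hy => by
    by_contra h0
    exact hy (hx (hψt (tsupport_fderiv_apply_subset ℝ _ (subset_tsupport _ h0))))
  rw [hL, hR, hind p' _ hv1, ← neg_eq_iff_eq_neg.2 (h.eq _ hψ), ← hind p _ hv2, ← integral_neg]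
  refine integral_congr_ae (Eventually.of_forall fun t => ?_)
  simp only [hpd]
  ring

/-- The bounded ratio of radii is what the Lebesgue differentiation theorem needs to give almost
everywhere convergence of the mollifications. -/
theorem exists_contDiffBump_seq : ∃ φ : ℕ → ContDiffBump (0 : Plane),
    Tendsto (fun n => (φ n).rOut) atTop (𝓝 0) ∧ ∀ n, (φ n).rOut ≤ 2 * (φ n).rIn := by
  refine ⟨fun n => ⟨1 / ((n : ℝ) + 1) / 2, 1 / ((n : ℝ) + 1), by positivity, ?_⟩, ?_, fun n => ?_⟩
  · exact half_lt_self (by positivity)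
  · exact tendsto_one_div_add_atTop_nhds_zero_nat
  · exact le_of_eq (by simp only; ring)

theorem locallyIntegrableOn_mono_restrict {Ω : Set Plane} {f g : Plane → ℝ}
    (hf : LocallyIntegrableOn f Ω) (hg : AEStronglyMeasurable g (volume.restrict Ω))
    (hgf : ∀ᵐ x ∂volume.restrict Ω, ‖g x‖ ≤ ‖f x‖) : LocallyIntegrableOn g Ω := by
  intro x hx
  obtain ⟨t, ht, hft⟩ := hf x hx
  refine ⟨t ∩ Ω, inter_mem ht self_mem_nhdsWithin, ?_⟩
  exact (hft.mono_set inter_subset_left).integrable.mono (hg.mono_set inter_subset_right)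
    (ae_restrict_of_ae_restrict_of_subset inter_subset_right hgf)

/-- Chain rule for weak partial derivatives. -/
theorem HasWeakPartial.comp_bounded {Ω : Set Plane} (hΩ : IsOpen Ω) {i : Fin 2}
    {p p' : Plane → ℝ} (h : HasWeakPartial Ω i p p') {s : ℝ → ℝ} (hs : ContDiff ℝ 1 s) {C : ℝ}
    (hsC : ∀ x, |s x| ≤ C) (hsC' : ∀ x, |deriv s x| ≤ C) :
    HasWeakPartial Ω i (fun x => s (p x)) (fun x => deriv s (p x) * p' x) := by
  have hpm := h.locInt.aestronglyMeasurable
  have hpm' := h.locInt'.aestronglyMeasurable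
  have hs' : Continuous (deriv s) := hs.continuous_deriv (le_refl _)
  refine ⟨?_, ?_, fun ψ hψ => ?_⟩
  · refine locallyIntegrableOn_mono_restrict (locallyIntegrableOn_const C) (hs.continuous.comp_aestronglyMeasurable hpm) ?_
    exact Eventually.of_forall fun x => (hsC _).trans (le_abs_self C)
  · refine locallyIntegrableOn_mono_restrict (h.locInt'.smul C) ((hs'.comp_aestronglyMeasurable hpm).mul hpm') ?_
    refine Eventually.of_forall fun x => ?_
    rw [norm_mul, Pi.smul_apply, norm_smul]
    exact mul_le_mul_of_nonneg_right ((hsC' _).trans (le_abs_self C)) (norm_nonneg _)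
  -- A compact collar of width `δ` around the support of `ψ` leaves room for every kernel of radius
  -- below `δ` centred in that support.
  obtain ⟨δ, hδ, hδΩ⟩ := hψ.compact.exists_cthickening_subset_open hΩ hψ.supp
  set K := Metric.cthickening δ (tsupport ψ) with hKdef
  have hK : IsCompact K := hψ.compact.cthickening
  have hKm := hK.measurableSet
  have hp : Integrable (K.indicator p) :=
    (integrable_indicator_iff hKm).2 (h.locInt.integrableOn_compact_subset hδΩ hK)
  have hp' : Integrable (K.indicator p') :=
    (integrable_indicator_iff hKm).2 (h.locInt'.integrableOn_compact_subset hδΩ hK)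
  obtain ⟨φ, hφ, hφ2⟩ := exists_contDiffBump_seq
  set f : ℕ → Plane → ℝ := fun n => (φ n).normed volume ⋆[lsmul ℝ ℝ] K.indicator p with hf
  set f' : ℕ → Plane → ℝ := fun n => (φ n).normed volume ⋆[lsmul ℝ ℝ] K.indicator p' with hf'
  have hfs : ∀ n, ContDiff ℝ 1 (f n) := fun n =>
    (φ n).hasCompactSupport_normed.contDiff_convolution_left _ (φ n).contDiff_normed
      hp.locallyIntegrable
  have hfs' : ∀ n, Continuous (f' n) := fun n =>
    ((φ n).hasCompactSupport_normed.contDiff_convolution_left (n := 1) _ (φ n).contDiff_normed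
      hp'.locallyIntegrable).continuous
  have hfae : ∀ᵐ x, Tendsto (fun n => f n x) atTop (𝓝 (K.indicator p x)) :=
    ContDiffBump.ae_convolution_tendsto_right_of_locallyIntegrable hφ
      (Eventually.of_forall hφ2) hp.locallyIntegrable
  have hψ1 : Continuous ψ := hψ.smooth.continuous
  have hψi : Integrable ψ := hψ1.integrable_of_hasCompactSupport hψ.compact
  have hψp : Continuous (pd i ψ) := (hψ.pd i).smooth.continuous
  have hψpi : Integrable (pd i ψ) := hψp.integrable_of_hasCompactSupport (hψ.pd i).compact
  -- integration by parts for the mollified functions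
  have hparts : ∀ᶠ n in atTop, ∫ x, s (f n x) * pd i ψ x = -∫ x, deriv s (f n x) * f' n x * ψ x := by
    filter_upwards [hφ.eventually (gt_mem_nhds hδ)] with n hn
    have hsf : ContDiff ℝ 1 (fun x => s (f n x)) := hs.comp (hfs n)
    have hfd : ∀ x, fderiv ℝ (fun x => s (f n x)) x (EuclideanSpace.single i 1) =
        deriv s (f n x) * pd i (f n) x := by
      intro x
      have h1 := ((hs.differentiable (by simp) (f n x)).hasDerivAt).comp_hasFDerivAt x
        ((hfs n).differentiable (by simp) x).hasFDerivAt
      have h2 : HasFDerivAt (fun x => s (f n x)) _ x := h1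
      rw [h2.fderiv]
      rfl
    have hcd : Continuous (fun x => fderiv ℝ (fun x => s (f n x)) x (EuclideanSpace.single i 1)) :=
      (hsf.continuous_fderiv (by simp)).clm_apply continuous_const
    have := integral_mul_fderiv_eq_neg_fderiv_mul_of_integrable (μ := (volume : Measure Plane))
      (f := fun x => s (f n x)) (g := ψ) (v := EuclideanSpace.single i (1 : ℝ))
      ((hcd.mul hψ1).integrable_of_hasCompactSupport hψ.compact.mul_left)
      ((hsf.continuous.mul hψp).integrable_of_hasCompactSupport (hψ.pd i).compact.mul_left)
      ((hsf.continuous.mul hψ1).integrable_of_hasCompactSupport hψ.compact.mul_left)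
      (fun x _ => hsf.differentiable (by simp) x)
      (fun x _ => hψ.smooth.differentiable (by simp) x)
    refine this.trans ?_
    congr 1
    refine integral_congr_ae (Eventually.of_forall fun x => ?_)
    simp only [hfd]
    by_cases hx : x ∈ tsupport ψ
    · rw [hf, hf', pd_convolution_normed h (φ n) hK hδΩ]
      refine (Metric.closedBall_subset_closedBall hn.le).trans ?_
      exact Metric.closedBall_subset_cthickening hx δ
    · rw [image_eq_zero_of_notMem_tsupport hx, mul_zero, mul_zero]
  have hlim1 : Tendsto (fun n => ∫ x, s (f n x) * pd i ψ x) atTop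
      (𝓝 (∫ x, s (K.indicator p x) * pd i ψ x)) := by
    refine tendsto_integral_of_dominated_convergence (fun x => C * |pd i ψ x|)
      (fun n => ((hs.continuous.comp (hfs n).continuous).mul hψp).aestronglyMeasurable)
      (hψpi.abs.const_mul C) (fun n => Eventually.of_forall fun x => ?_) ?_
    · rw [norm_mul]
      exact mul_le_mul_of_nonneg_right (hsC _) (norm_nonneg _)
    · filter_upwards [hfae] with x hx
      exact ((hs.continuous.tendsto _).comp hx).mul_const _
  have hlim2 : Tendsto (fun n => ∫ x, deriv s (f n x) * K.indicator p' x * ψ x) atTop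
      (𝓝 (∫ x, deriv s (K.indicator p x) * K.indicator p' x * ψ x)) := by
    obtain ⟨M, hM⟩ := hψ.compact.exists_bound_of_continuous hψ1
    refine tendsto_integral_of_dominated_convergence (fun x => C * |K.indicator p' x| * M)
      (fun n => (((hs'.comp (hfs n).continuous).aestronglyMeasurable.mul
        hp'.aestronglyMeasurable).mul hψ1.aestronglyMeasurable))
      ((hp'.abs.const_mul C).mul_const M) (fun n => Eventually.of_forall fun x => ?_) ?_
    · rw [norm_mul, norm_mul]
      have hC0 : 0 ≤ C := (abs_nonneg _).trans (hsC 0)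
      exact mul_le_mul (mul_le_mul_of_nonneg_right (hsC' _) (norm_nonneg _)) (hM x)
        (norm_nonneg _) (mul_nonneg hC0 (abs_nonneg _))
    · filter_upwards [hfae] with x hx
      exact (((hs'.tendsto _).comp hx).mul_const _).mul_const _
  -- The mollified derivatives converge only in `L¹`, so the limit is split: this error is
  -- controlled by the bound on `deriv s`, while `hlim2` treats the fixed factor `p'` by dominated
  -- convergence.
  have hlim3 : Tendsto (fun n => ∫ x, deriv s (f n x) * (f' n x - K.indicator p' x) * ψ x) atTop
      (𝓝 0) := by
    obtain ⟨M, hM⟩ := hψ.compact.exists_bound_of_continuous hψ1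
    have hC0 : 0 ≤ C := (abs_nonneg _).trans (hsC 0)
    have h0 := tendsto_lintegral_convolution_sub hp' hφ
    rw [tendsto_zero_iff_enorm_tendsto_zero]
    have h1 : Tendsto (fun n => ENNReal.ofReal (C * M) * ∫⁻ x, ‖f' n x - K.indicator p' x‖ₑ) atTop
        (𝓝 0) := by
      simpa using ENNReal.Tendsto.const_mul h0 (Or.inr ENNReal.ofReal_ne_top)
    refine tendsto_of_tendsto_of_tendsto_of_le_of_le tendsto_const_nhds h1 (fun _ => zero_le)
      fun n => ?_
    refine (enorm_integral_le_lintegral_enorm _).trans ?_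
    rw [← lintegral_const_mul' _ _ ENNReal.ofReal_ne_top]
    refine lintegral_mono fun x => ?_
    rw [enorm_mul, enorm_mul, mul_right_comm, ← enorm_mul]
    refine mul_le_mul_left ?_ _
    rw [← ofReal_norm, norm_mul]
    exact ENNReal.ofReal_le_ofReal (mul_le_mul (hsC' _) (hM x) (norm_nonneg _) hC0)
  have hi1 : ∀ n, Integrable fun x => deriv s (f n x) * K.indicator p' x * ψ x := by
    intro n
    obtain ⟨M, hM⟩ := hψ.compact.exists_bound_of_continuous hψ1
    refine (hp'.bdd_mul (c := C) ((hs'.comp (hfs n).continuous).aestronglyMeasurable)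
      (Eventually.of_forall fun x => hsC' _)).mul_bdd (c := M) hψ1.aestronglyMeasurable
      (Eventually.of_forall hM)
  have hi2 : ∀ n, Integrable fun x => deriv s (f n x) * f' n x * ψ x := fun n =>
    (((hs'.comp (hfs n).continuous).mul (hfs' n)).mul hψ1).integrable_of_hasCompactSupport
      hψ.compact.mul_left
  have hlim4 : Tendsto (fun n => ∫ x, deriv s (f n x) * f' n x * ψ x) atTop
      (𝓝 (∫ x, deriv s (K.indicator p x) * K.indicator p' x * ψ x)) := by
    have := hlim3.add hlim2
    rw [zero_add] at this
    refine this.congr fun n => ?_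
    have hi3 : Integrable fun x => deriv s (f n x) * (f' n x - K.indicator p' x) * ψ x := by
      refine ((hi2 n).sub (hi1 n)).congr (Eventually.of_forall fun x => ?_)
      simp only [Pi.sub_apply]
      ring
    rw [← integral_add hi3 (hi1 n)]
    refine integral_congr_ae (Eventually.of_forall fun x => ?_)
    simp only
    ring
  have hfin := tendsto_nhds_unique (hlim1.congr' hparts) hlim4.neg
  have hsub : tsupport ψ ⊆ K := Metric.self_subset_cthickening _
  have e1 : ∫ x in Ω, s (p x) * pd i ψ x = ∫ x, s (K.indicator p x) * pd i ψ x := by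
    rw [setIntegral_eq_integral_of_forall_compl_eq_zero]
    · refine integral_congr_ae (Eventually.of_forall fun x => ?_)
      by_cases hx : x ∈ K
      · simp only [indicator_of_mem hx]
      · have : pd i ψ x = 0 := by
          by_contra h0
          exact hx (hsub (tsupport_fderiv_apply_subset ℝ _ (subset_tsupport _ h0)))
        simp only [this, mul_zero]
    · intro x hx
      have : pd i ψ x = 0 := by
        by_contra h0
        exact hx ((hψ.pd i).supp (subset_tsupport _ h0))
      rw [this, mul_zero]
  have e2 : ∫ x in Ω, deriv s (p x) * p' x * ψ x =
      ∫ x, deriv s (K.indicator p x) * K.indicator p' x * ψ x := by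
    rw [setIntegral_eq_integral_of_forall_compl_eq_zero]
    · refine integral_congr_ae (Eventually.of_forall fun x => ?_)
      by_cases hx : x ∈ K
      · simp only [indicator_of_mem hx]
      · simp only [image_eq_zero_of_notMem_tsupport fun h0 => hx (hsub h0), mul_zero]
    · intro x hx
      rw [image_eq_zero_of_notMem_tsupport fun h0 => hx (hψ.supp h0), mul_zero]
  rw [e1, e2, hfin]

end BonaSmith

/-! ### Limits, truncations, the product rule and uniqueness for weak derivatives. -/

namespace BonaSmith

open Filter Topology

variable {Ω : Set Plane}

theorem IsTest.exists_bound {ψ : Plane → ℝ} (h : IsTest Ω ψ) : ∃ M, ∀ x, ‖ψ x‖ ≤ M :=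
  h.compact.exists_bound_of_continuous h.smooth.continuous

theorem IsTest.integrable_mul_of_locallyIntegrableOn {ψ : Plane → ℝ} (h : IsTest Ω ψ)
    {f : Plane → ℝ} (hf : LocallyIntegrableOn f Ω) : IntegrableOn (fun x => f x * ψ x) Ω := by
  obtain ⟨M, hM⟩ := h.exists_bound
  have h1 : IntegrableOn (fun x => f x * ψ x) (tsupport ψ) :=
    (hf.integrableOn_compact_subset h.supp h.compact).mul_bdd (c := M)
      h.smooth.continuous.aestronglyMeasurable (Eventually.of_forall hM)
  exact (integrableOn_iff_integrable_of_support_subset fun x hx => subset_tsupport ψ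
    (right_ne_zero_of_mul hx)).1 h1 |>.integrableOn

theorem locallyIntegrableOn_congr_ae {f g : Plane → ℝ}
    (hf : LocallyIntegrableOn f Ω) (h : f =ᵐ[volume.restrict Ω] g) : LocallyIntegrableOn g Ω :=
  locallyIntegrableOn_mono_restrict hf (hf.aestronglyMeasurable.congr h)
    (h.mono fun x hx => by rw [hx])

namespace HasWeakPartial

variable {i : Fin 2} {f g f' g' : Plane → ℝ}

theorem congr_ae (h : HasWeakPartial Ω i f g) (hf : f =ᵐ[volume.restrict Ω] f')
    (hg : g =ᵐ[volume.restrict Ω] g') : HasWeakPartial Ω i f' g' where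
  locInt := locallyIntegrableOn_congr_ae h.locInt hf
  locInt' := locallyIntegrableOn_congr_ae h.locInt' hg
  eq ψ hψ := by
    exact (integral_congr_ae (hf.mul (ae_eq_refl (BonaSmith.pd i ψ)))).symm.trans
      ((h.eq ψ hψ).trans (congrArg Neg.neg (integral_congr_ae (hg.mul (ae_eq_refl ψ)))))

theorem add_fun (h : HasWeakPartial Ω i f g) (h' : HasWeakPartial Ω i f' g') :
    HasWeakPartial Ω i (fun x => f x + f' x) (fun x => g x + g' x) where
  locInt := h.locInt.add h'.locInt
  locInt' := h.locInt'.add h'.locInt'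
  eq ψ hψ := by
    simp only [add_mul]
    rw [integral_add ((hψ.pd i).integrable_mul_of_locallyIntegrableOn h.locInt)
      ((hψ.pd i).integrable_mul_of_locallyIntegrableOn h'.locInt),
      integral_add (hψ.integrable_mul_of_locallyIntegrableOn h.locInt')
      (hψ.integrable_mul_of_locallyIntegrableOn h'.locInt'), h.eq ψ hψ, h'.eq ψ hψ, neg_add]

theorem const_mul (a : ℝ) (h : HasWeakPartial Ω i f g) :
    HasWeakPartial Ω i (fun x => a * f x) (fun x => a * g x) where
  locInt := h.locInt.smul a
  locInt' := h.locInt'.smul a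
  eq ψ hψ := by
    simp only [mul_assoc]
    rw [integral_const_mul, integral_const_mul, h.eq ψ hψ, mul_neg]

theorem sum_fun {ι : Type*} (s : Finset ι) {f g : ι → Plane → ℝ}
    (h : ∀ j, HasWeakPartial Ω i (f j) (g j)) :
    HasWeakPartial Ω i (fun x => ∑ j ∈ s, f j x) (fun x => ∑ j ∈ s, g j x) := by
  classical
  induction s using Finset.induction_on with
  | empty =>
    simp only [Finset.sum_empty]
    exact ⟨locallyIntegrableOn_zero, locallyIntegrableOn_zero, by simp⟩
  | insert a s ha ih =>
    simp only [Finset.sum_insert ha]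
    exact (h a).add_fun ih

/-- Weak partial derivatives pass to dominated limits. -/
theorem of_tendsto_of_dominated {u v : ℕ → Plane → ℝ} {F G : Plane → ℝ}
    (h : ∀ n, HasWeakPartial Ω i (u n) (v n)) (hF : IntegrableOn F Ω) (hG : IntegrableOn G Ω)
    (huF : ∀ n, ∀ᵐ x ∂volume.restrict Ω, ‖u n x‖ ≤ F x)
    (hvG : ∀ n, ∀ᵐ x ∂volume.restrict Ω, ‖v n x‖ ≤ G x)
    (hu : ∀ᵐ x ∂volume.restrict Ω, Tendsto (fun n => u n x) atTop (𝓝 (f x)))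
    (hv : ∀ᵐ x ∂volume.restrict Ω, Tendsto (fun n => v n x) atTop (𝓝 (g x))) :
    HasWeakPartial Ω i f g := by
  have key : ∀ {w : ℕ → Plane → ℝ} {W w₀ : Plane → ℝ},
      (∀ n, AEStronglyMeasurable (w n) (volume.restrict Ω)) → IntegrableOn W Ω →
      (∀ n, ∀ᵐ x ∂volume.restrict Ω, ‖w n x‖ ≤ W x) →
      (∀ᵐ x ∂volume.restrict Ω, Tendsto (fun n => w n x) atTop (𝓝 (w₀ x))) →
      LocallyIntegrableOn w₀ Ω ∧ ∀ ψ, IsTest Ω ψ →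
        Tendsto (fun n => ∫ x in Ω, w n x * ψ x) atTop (𝓝 (∫ x in Ω, w₀ x * ψ x)) := by
    intro w W w₀ hm hW hb hl
    constructor
    · have hm0 := aestronglyMeasurable_of_tendsto_ae _ hm hl
      have : IntegrableOn w₀ Ω := hW.mono' hm0 (by
        filter_upwards [ae_all_iff.2 hb, hl] with x hx hx'
        exact le_of_tendsto hx'.norm (Eventually.of_forall hx))
      exact this.locallyIntegrableOn
    · intro ψ hψ
      obtain ⟨M, hM⟩ := hψ.exists_bound
      refine tendsto_integral_of_dominated_convergence (fun x => W x * M)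
        (fun n => (hm n).mul hψ.smooth.continuous.aestronglyMeasurable) (hW.mul_const M)
        (fun n => ?_) ?_
      · filter_upwards [hb n] with x hx
        rw [norm_mul]
        exact mul_le_mul hx (hM x) (norm_nonneg _) ((norm_nonneg _).trans hx)
      · filter_upwards [hl] with x hx
        exact hx.mul_const _
  obtain ⟨h1, h2⟩ := key (fun n => (h n).locInt.aestronglyMeasurable) hF huF hu
  obtain ⟨h3, h4⟩ := key (fun n => (h n).locInt'.aestronglyMeasurable) hG hvG hv
  exact ⟨h1, h3, fun ψ hψ => tendsto_nhds_unique ((h2 _ (hψ.pd i)).congr fun n => (h n).eq ψ hψ)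
    (h4 ψ hψ).neg⟩

end HasWeakPartial

/-- A bounded smooth approximation of `x ↦ x ^ 2`. -/
noncomputable def sqApprox (k : ℕ) (x : ℝ) : ℝ := x ^ 2 / (1 + x ^ 2 / (k + 1))

/-- A bounded smooth approximation of the identity. -/
noncomputable def idApprox (k : ℕ) (x : ℝ) : ℝ := x / (1 + x ^ 2 / (k + 1))

theorem one_le_den (k : ℕ) (x : ℝ) : 1 ≤ 1 + x ^ 2 / (k + 1) := by
  have : 0 ≤ x ^ 2 / ((k : ℝ) + 1) := by positivity
  linarith

theorem hasDerivAt_den (k : ℕ) (x : ℝ) :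
    HasDerivAt (fun x : ℝ => 1 + x ^ 2 / ((k : ℝ) + 1)) (2 * x / (k + 1)) x := by
  simpa using ((hasDerivAt_pow 2 x).div_const ((k : ℝ) + 1)).const_add 1

theorem tendsto_den (x : ℝ) : Tendsto (fun k : ℕ => 1 + x ^ 2 / ((k : ℝ) + 1)) atTop (𝓝 1) := by
  have := (tendsto_one_div_add_atTop_nhds_zero_nat (𝕜 := ℝ)).const_mul (x ^ 2)
  simpa [div_eq_mul_inv] using this.const_add 1

theorem contDiff_sqApprox (k : ℕ) : ContDiff ℝ 1 (sqApprox k) :=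
  (contDiff_id.pow 2).div (contDiff_const.add ((contDiff_id.pow 2).div_const _))
    fun x => (zero_lt_one.trans_le (one_le_den k x)).ne'

theorem contDiff_idApprox (k : ℕ) : ContDiff ℝ 1 (idApprox k) :=
  contDiff_id.div (contDiff_const.add ((contDiff_id.pow 2).div_const _))
    fun x => (zero_lt_one.trans_le (one_le_den k x)).ne'

theorem deriv_sqApprox (k : ℕ) (x : ℝ) :
    deriv (sqApprox k) x = 2 * x / (1 + x ^ 2 / (k + 1)) ^ 2 := by
  have h := (hasDerivAt_pow 2 x).div (hasDerivAt_den k x)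
    (zero_lt_one.trans_le (one_le_den k x)).ne'
  have h' : HasDerivAt (sqApprox k) _ x := h
  rw [h'.deriv]
  congr 1
  field_simp
  simp
  ring

theorem deriv_idApprox (k : ℕ) (x : ℝ) :
    deriv (idApprox k) x = (1 - x ^ 2 / (k + 1)) / (1 + x ^ 2 / (k + 1)) ^ 2 := by
  have h := (hasDerivAt_id x).div (hasDerivAt_den k x)
    (zero_lt_one.trans_le (one_le_den k x)).ne'
  have h' : HasDerivAt (idApprox k) _ x := h
  rw [h'.deriv]
  congr 1
  field_simp
  simp
  ring

theorem abs_sqApprox_le (k : ℕ) (x : ℝ) : |sqApprox k x| ≤ x ^ 2 := by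
  rw [sqApprox, abs_of_nonneg (div_nonneg (sq_nonneg x) (zero_le_one.trans (one_le_den k x)))]
  exact div_le_self (sq_nonneg x) (one_le_den k x)

/-- Two kinds of bound are needed for each truncation: those depending on `k` but not on `x` make
the bounded chain rule applicable, and those uniform in `k` give the dominating functions as `k →
∞`. -/
theorem abs_sqApprox_le' (k : ℕ) (x : ℝ) : |sqApprox k x| ≤ k + 1 := by
  have hd := one_le_den k x
  rw [sqApprox, abs_of_nonneg (div_nonneg (sq_nonneg x) (zero_le_one.trans hd)),
    div_le_iff₀ (zero_lt_one.trans_le hd)]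
  have : ((k : ℝ) + 1) * (x ^ 2 / (k + 1)) = x ^ 2 := by field_simp
  nlinarith

theorem abs_deriv_sqApprox_le (k : ℕ) (x : ℝ) : |deriv (sqApprox k) x| ≤ 2 * |x| := by
  have hd := one_le_den k x
  rw [deriv_sqApprox, abs_div, abs_mul, abs_two, abs_of_nonneg (a := (1 + _) ^ 2) (sq_nonneg (1 + x ^ 2 / ((k : ℝ) + 1)))]
  exact div_le_self (by positivity) (one_le_pow₀ hd)

theorem abs_deriv_sqApprox_le' (k : ℕ) (x : ℝ) : |deriv (sqApprox k) x| ≤ k + 2 := by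
  have hd := one_le_den k x
  rw [deriv_sqApprox, abs_div, abs_mul, abs_two, abs_of_nonneg (a := (1 + _) ^ 2) (sq_nonneg (1 + x ^ 2 / ((k : ℝ) + 1))),
    div_le_iff₀ (by positivity)]
  have h1 : ((k : ℝ) + 1) * (x ^ 2 / (k + 1)) = x ^ 2 := by field_simp
  -- With `y = x² / (k + 1)`, the chain is `2|x| ≤ 1 + (k + 1) y ≤ (k + 2)(1 + y)²`.
  have h2 : 2 * |x| ≤ 1 + x ^ 2 := by nlinarith [sq_nonneg (|x| - 1), sq_abs x]
  have h3 : 1 + x ^ 2 / ((k : ℝ) + 1) ≤ (1 + x ^ 2 / (k + 1)) ^ 2 := by nlinarith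
  have h4 : 0 ≤ x ^ 2 / ((k : ℝ) + 1) := by positivity
  have h5 : (0 : ℝ) ≤ k := k.cast_nonneg
  nlinarith

theorem abs_idApprox_le (k : ℕ) (x : ℝ) : |idApprox k x| ≤ |x| := by
  rw [idApprox, abs_div, abs_of_nonneg (zero_le_one.trans (one_le_den k x))]
  exact div_le_self (abs_nonneg x) (one_le_den k x)

theorem abs_idApprox_le' (k : ℕ) (x : ℝ) : |idApprox k x| ≤ k + 1 := by
  have hd := one_le_den k x
  rw [idApprox, abs_div, abs_of_nonneg (zero_le_one.trans hd),
    div_le_iff₀ (zero_lt_one.trans_le hd)]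
  have h1 : ((k : ℝ) + 1) * (x ^ 2 / (k + 1)) = x ^ 2 := by field_simp
  have h5 : (0 : ℝ) ≤ k := k.cast_nonneg
  nlinarith [sq_nonneg (|x| - 1), sq_abs x]

theorem abs_deriv_idApprox_le (k : ℕ) (x : ℝ) : |deriv (idApprox k) x| ≤ 1 := by
  have hd := one_le_den k x
  have h4 : 0 ≤ x ^ 2 / ((k : ℝ) + 1) := by positivity
  rw [deriv_idApprox, abs_div, abs_of_nonneg (a := (1 + _) ^ 2) (sq_nonneg (1 + x ^ 2 / ((k : ℝ) + 1))), div_le_one (by positivity),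
    abs_le]
  constructor <;> nlinarith

theorem tendsto_sqApprox (x : ℝ) : Tendsto (fun k => sqApprox k x) atTop (𝓝 (x ^ 2)) := by
  have := (tendsto_const_nhds (x := x ^ 2)).div (tendsto_den x) one_ne_zero
  rwa [div_one] at this

theorem tendsto_deriv_sqApprox (x : ℝ) :
    Tendsto (fun k => deriv (sqApprox k) x) atTop (𝓝 (2 * x)) := by
  simp only [deriv_sqApprox]
  have := (tendsto_const_nhds (x := 2 * x)).div ((tendsto_den x).pow 2) (by simp)
  rwa [one_pow, div_one] at this

theorem tendsto_idApprox (x : ℝ) : Tendsto (fun k => idApprox k x) atTop (𝓝 x) := by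
  have := (tendsto_const_nhds (x := x)).div (tendsto_den x) one_ne_zero
  rwa [div_one] at this

theorem tendsto_deriv_idApprox (x : ℝ) :
    Tendsto (fun k => deriv (idApprox k) x) atTop (𝓝 1) := by
  simp only [deriv_idApprox]
  have h : ∀ k : ℕ, 1 - x ^ 2 / ((k : ℝ) + 1) = 2 - (1 + x ^ 2 / (k + 1)) := fun k => by ring
  simp only [h]
  have := ((tendsto_den x).const_sub 2).div ((tendsto_den x).pow 2) (by simp)
  norm_num at this
  exact this

namespace HasWeakPartial

variable {i : Fin 2} {p p' q q' : Plane → ℝ}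

theorem idApprox (hΩ : IsOpen Ω) (h : HasWeakPartial Ω i p p') (k : ℕ) :
    HasWeakPartial Ω i (fun x => BonaSmith.idApprox k (p x))
      (fun x => deriv (BonaSmith.idApprox k) (p x) * p' x) := by
  have h5 : (0 : ℝ) ≤ k := k.cast_nonneg
  exact h.comp_bounded hΩ (contDiff_idApprox k) (abs_idApprox_le' k)
    fun x => (abs_deriv_idApprox_le k x).trans (by linarith)

/-- The chain rule applies to each bounded approximation of the square; the values are dominated by
`p²` and the derivatives by `2|p p'|`, both integrable. -/
theorem sq (hΩ : IsOpen Ω) (h : HasWeakPartial Ω i p p') (hp : MemLp p 2 (volume.restrict Ω))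
    (hp' : MemLp p' 2 (volume.restrict Ω)) :
    HasWeakPartial Ω i (fun x => p x ^ 2) (fun x => 2 * p x * p' x) := by
  refine of_tendsto_of_dominated (u := fun k x => sqApprox k (p x))
    (v := fun k x => deriv (sqApprox k) (p x) * p' x) (F := fun x => p x ^ 2)
    (G := fun x => 2 * |p x * p' x|)
    (fun k => h.comp_bounded hΩ (contDiff_sqApprox k)
      (fun x => (abs_sqApprox_le' k x).trans (by linarith)) (abs_deriv_sqApprox_le' k)) hp.integrable_sq
    ((hp.integrable_mul hp').abs.const_mul 2) (fun k => Eventually.of_forall fun x => ?_)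
    (fun k => Eventually.of_forall fun x => ?_) (Eventually.of_forall fun x => tendsto_sqApprox _)
    (Eventually.of_forall fun x => (tendsto_deriv_sqApprox _).mul_const _)
  · exact abs_sqApprox_le k _
  · rw [norm_mul, abs_mul, ← mul_assoc]
    exact mul_le_mul_of_nonneg_right (abs_deriv_sqApprox_le k _) (norm_nonneg _)

/-- Product rule for weak partial derivatives in `L²`. -/
theorem mul (hΩ : IsOpen Ω) (h : HasWeakPartial Ω i p p') (h' : HasWeakPartial Ω i q q')
    (hp : MemLp p 2 (volume.restrict Ω)) (hp' : MemLp p' 2 (volume.restrict Ω))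
    (hq : MemLp q 2 (volume.restrict Ω)) (hq' : MemLp q' 2 (volume.restrict Ω)) :
    HasWeakPartial Ω i (fun x => p x * q x) (fun x => p' x * q x + p x * q' x) := by
  -- Polarization: `pq = ((p + q)² - (p - q)²) / 4`.
  have h1 := ((h.add_fun h').sq hΩ (hp.add hq) (hp'.add hq')).const_mul (1 / 4)
  have h2 := ((h.add_fun (h'.const_mul (-1))).sq hΩ (hp.add (hq.const_mul (-1)))
    (hp'.add (hq'.const_mul (-1)))).const_mul (-1 / 4)
  refine (h1.add_fun h2).congr_ae (Eventually.of_forall fun x => ?_)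
    (Eventually.of_forall fun x => ?_) <;> · simp only; ring

end HasWeakPartial

theorem ae_eq_of_forall_test (hΩ : IsOpen Ω) {m n : Plane → ℝ} (hm : LocallyIntegrableOn m Ω)
    (hn : LocallyIntegrableOn n Ω)
    (h : ∀ ψ, IsTest Ω ψ → ∫ x in Ω, m x * ψ x = ∫ x in Ω, n x * ψ x) :
    m =ᵐ[volume.restrict Ω] n := by
  have h0 := hΩ.ae_eq_zero_of_integral_contDiff_smul_eq_zero (μ := volume) (hm.sub hn)
    fun ψ h1 h2 h3 => by
      have hψ : IsTest Ω ψ := ⟨h1, h2, h3⟩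
      have : ∫ x in Ω, (m x * ψ x - n x * ψ x) = 0 := by
        rw [integral_sub (hψ.integrable_mul_of_locallyIntegrableOn hm)
          (hψ.integrable_mul_of_locallyIntegrableOn hn), h ψ hψ, sub_self]
      rw [setIntegral_eq_integral_of_forall_compl_eq_zero] at this
      · rw [← this]
        refine integral_congr_ae (Eventually.of_forall fun x => ?_)
        simp only [Pi.sub_apply, smul_eq_mul]
        ring
      · intro x hx
        have : ψ x = 0 := image_eq_zero_of_notMem_tsupport fun h => hx (h3 h)
        simp [this]
  rw [EventuallyEq, ae_restrict_iff' hΩ.measurableSet]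
  filter_upwards [h0] with x hx hxΩ
  exact sub_eq_zero.1 (hx hxΩ)

/-- This identifies the divergences that the equations and the normal trace condition only assert to
exist with explicit ones. -/
theorem HasWeakDiv.unique (hΩ : IsOpen Ω) {V : Fin 2 → Plane → ℝ} {m n : Plane → ℝ}
    (hm : HasWeakDiv Ω V m) (hn : HasWeakDiv Ω V n) : m =ᵐ[volume.restrict Ω] n :=
  ae_eq_of_forall_test hΩ hm.locInt' hn.locInt' fun ψ hψ =>
    neg_injective ((hm.eq ψ hψ).symm.trans (hn.eq ψ hψ))

theorem HasWeakDiv.of_hasWeakPartial {V W : Fin 2 → Plane → ℝ}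
    (h : ∀ i, HasWeakPartial Ω i (V i) (W i)) : HasWeakDiv Ω V (fun x => ∑ i, W i x) where
  locInt i := (h i).locInt
  locInt' := by
    simp only [Fin.sum_univ_two]
    exact (h 0).locInt'.add (h 1).locInt'
  eq ψ hψ := by
    simp only [Finset.sum_mul]
    rw [integral_finsetSum _ fun i _ =>
      (hψ.pd i).integrable_mul_of_locallyIntegrableOn (h i).locInt,
      integral_finsetSum _ fun i _ => hψ.integrable_mul_of_locallyIntegrableOn (h i).locInt',
      ← Finset.sum_neg_distrib]
    exact Finset.sum_congr rfl fun i _ => (h i).eq ψ hψ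

end BonaSmith

/-! ### Operators on `H²` and integration by parts under a vanishing normal trace. -/

namespace BonaSmith

open Filter Topology

variable {Ω : Set Plane}

theorem L2.inner_eq_integral (f g : L2 Ω) : inner ℝ f g = ∫ x in Ω, f x * g x := by
  rw [L2.inner_def]
  refine integral_congr_ae (Eventually.of_forall fun x => ?_)
  simp [mul_comm]

/-- Multiplication by an essentially bounded function as an operator on `L²(Ω)`. -/
noncomputable def mulL {a : Plane → ℝ} (ha : MemLp a ∞ (volume.restrict Ω)) : L2 Ω →L[ℝ] L2 Ω :=
  (ContinuousLinearMap.mul ℝ ℝ).holderL (volume.restrict Ω) ∞ 2 2 (ha.toLp a)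

theorem coeFn_mulL {a : Plane → ℝ} (ha : MemLp a ∞ (volume.restrict Ω)) (f : L2 Ω) :
    mulL ha f =ᵐ[volume.restrict Ω] fun x => a x * f x := by
  have h1 := (ContinuousLinearMap.mul ℝ ℝ).coeFn_holder (r := 2) (ha.toLp a) f
  filter_upwards [h1, ha.coeFn_toLp] with x hx hx'
  rw [← hx']
  exact hx

/-- The function underlying `u ∈ H²(Ω)`, as a continuous linear map. -/
noncomputable def H2.fnL : H2 Ω →L[ℝ] L2 Ω :=
  (ContinuousLinearMap.fst ℝ _ _).comp (sobolevH2 Ω).subtypeL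

/-- The weak partial derivative, as a continuous linear map on `H²(Ω)`. -/
noncomputable def H2.dL (i : Fin 2) : H2 Ω →L[ℝ] L2 Ω :=
  (ContinuousLinearMap.proj i).comp ((ContinuousLinearMap.fst ℝ _ _).comp
    ((ContinuousLinearMap.snd ℝ _ _).comp (sobolevH2 Ω).subtypeL))

/-- The second weak partial derivative, as a continuous linear map on `H²(Ω)`. -/
noncomputable def H2.ddL (i j : Fin 2) : H2 Ω →L[ℝ] L2 Ω :=
  (ContinuousLinearMap.proj j).comp ((ContinuousLinearMap.proj i).comp
    ((ContinuousLinearMap.snd ℝ _ _).comp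
      ((ContinuousLinearMap.snd ℝ _ _).comp (sobolevH2 Ω).subtypeL)))

/-- The weak gradient, as a continuous linear map `H²(Ω) → H¹(Ω)²`. -/
noncomputable def H2.gradL : H2 Ω →L[ℝ] (Fin 2 → H1 Ω) :=
  ContinuousLinearMap.pi fun i =>
    (((H2.dL i).prod (ContinuousLinearMap.pi fun j => H2.ddL i j)).codRestrict (sobolevH1 Ω)
      fun u => u.2.2 i)

theorem H2.hasWeakPartial_fnL (u : H2 Ω) (i : Fin 2) :
    HasWeakPartial Ω i (H2.fnL u) (H2.dL i u) := u.2.1 i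

theorem H2.hasWeakPartial_dL (u : H2 Ω) (i j : Fin 2) :
    HasWeakPartial Ω j (H2.dL i u) (H2.ddL i j u) := u.2.2 i j

theorem MemLp.mul_top_left {a f : Plane → ℝ} (ha : MemLp a ∞ (volume.restrict Ω))
    (hf : MemLp f 2 (volume.restrict Ω)) : MemLp (fun x => a x * f x) 2 (volume.restrict Ω) :=
  MemLp.mul' hf ha

section DivGrad

variable {a : Plane → ℝ} {a' : Fin 2 → Plane → ℝ} (ha : MemLp a ∞ (volume.restrict Ω))
  (ha' : ∀ i, MemLp (a' i) ∞ (volume.restrict Ω))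

/-- The operator `u ↦ ∇·(a∇u)` from `H²(Ω)` to `L²(Ω)`, where `a' = ∇a`. -/
noncomputable def divGrad : H2 Ω →L[ℝ] L2 Ω :=
  ∑ i, ((mulL (ha' i)).comp (H2.dL i) + (mulL ha).comp (H2.ddL i i))

theorem coeFn_divGrad (u : H2 Ω) : divGrad ha ha' u =ᵐ[volume.restrict Ω]
    fun x => ∑ i, (a' i x * H2.dL i u x + a x * H2.ddL i i u x) := by
  have h : divGrad ha ha' u = (mulL (ha' 0) (H2.dL 0 u) + mulL ha (H2.ddL 0 0 u)) +
      (mulL (ha' 1) (H2.dL 1 u) + mulL ha (H2.ddL 1 1 u)) := by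
    simp [divGrad, Fin.sum_univ_two]
  rw [h]
  filter_upwards [Lp.coeFn_add (mulL (ha' 0) (H2.dL 0 u) + mulL ha (H2.ddL 0 0 u))
    (mulL (ha' 1) (H2.dL 1 u) + mulL ha (H2.ddL 1 1 u)),
    Lp.coeFn_add (mulL (ha' 0) (H2.dL 0 u)) (mulL ha (H2.ddL 0 0 u)),
    Lp.coeFn_add (mulL (ha' 1) (H2.dL 1 u)) (mulL ha (H2.ddL 1 1 u)),
    coeFn_mulL (ha' 0) (H2.dL 0 u), coeFn_mulL (ha' 1) (H2.dL 1 u),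
    coeFn_mulL ha (H2.ddL 0 0 u), coeFn_mulL ha (H2.ddL 1 1 u)] with x h1 h2 h3 h4 h5 h6 h7
  rw [h1, Pi.add_apply, h2, h3, Pi.add_apply, Pi.add_apply, h4, h5, h6, h7, Fin.sum_univ_two]

theorem ZeroNormalTrace.integral_eq_zero (hΩ : IsOpen Ω) {V : Fin 2 → Plane → ℝ}
    (hV : ZeroNormalTrace Ω V) {m : Plane → ℝ} (hm : HasWeakDiv Ω V m) {f : Plane → ℝ}
    {f' : Fin 2 → Plane → ℝ} (hf : MemLp f 2 (volume.restrict Ω))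
    (hf' : ∀ i, MemLp (f' i) 2 (volume.restrict Ω)) (h : ∀ i, HasWeakPartial Ω i f (f' i)) :
    ∫ x in Ω, (m x * f x + ∑ i, V i x * f' i x) = 0 := by
  obtain ⟨-, n, -, hn, hw⟩ := hV
  let w : H1 Ω := ⟨(hf.toLp f, fun i => (hf' i).toLp (f' i)), fun i =>
    (h i).congr_ae hf.coeFn_toLp.symm (hf' i).coeFn_toLp.symm⟩
  rw [← hw w]
  refine integral_congr_ae ?_
  have h1 : w.fn =ᵐ[volume.restrict Ω] f := hf.coeFn_toLp
  have h2 : ∀ i, w.d i =ᵐ[volume.restrict Ω] f' i := fun i => (hf' i).coeFn_toLp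
  filter_upwards [h1, ae_all_iff.2 h2, hm.unique hΩ hn] with x h1 h2 h3
  simp only [h1, h2, h3]

variable [IsFiniteMeasure (volume.restrict Ω)]

theorem hasWeakDiv_divGrad (hΩ : IsOpen Ω) (h : ∀ i, HasWeakPartial Ω i a (a' i)) (u : H2 Ω) :
    HasWeakDiv Ω (fun i x => a x * H2.dL i u x) (divGrad ha ha' u) := by
  have h1 := HasWeakDiv.of_hasWeakPartial fun i => (h i).mul hΩ (u.hasWeakPartial_dL i i)
    (ha.mono_exponent le_top) ((ha' i).mono_exponent le_top) (Lp.memLp _) (Lp.memLp _)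
  have h2 := coeFn_divGrad ha ha' u
  exact ⟨h1.locInt, (divGrad ha ha' u).locInt, fun ψ hψ => (h1.eq ψ hψ).trans
    (congrArg Neg.neg (integral_congr_ae (h2.mul (ae_eq_refl ψ))).symm)⟩

/-- The test function for the field `∇u` is `a w`, which lies in `H¹` since `a` and `∇a` are
bounded. Expanding `Δu · aw + ∇u · ∇(aw)` gives `∇·(a∇u) w + a∇u·∇w`, so the normal trace of `a∇u`
need not be discussed. -/
theorem ZeroNormalTrace.inner_divGrad (hΩ : IsOpen Ω) (h : ∀ i, HasWeakPartial Ω i a (a' i))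
    {u : H2 Ω} (hu : ZeroNormalTrace Ω u.d) (w : H2 Ω) :
    inner ℝ (H2.fnL w) (divGrad ha ha' u) + ∑ i, inner ℝ (H2.dL i w) (mulL ha (H2.dL i u)) = 0 := by
  have hw : MemLp (H2.fnL w) 2 (volume.restrict Ω) := Lp.memLp _
  have hw' : ∀ i, MemLp (H2.dL i w) 2 (volume.restrict Ω) := fun i => Lp.memLp _
  have h1 := hu.integral_eq_zero hΩ
    (HasWeakDiv.of_hasWeakPartial fun i => u.hasWeakPartial_dL i i)
    (MemLp.mul_top_left ha hw)
    (fun i => (MemLp.mul_top_left (ha' i) hw).add (MemLp.mul_top_left ha (hw' i)))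
    (fun i => (h i).mul hΩ (w.hasWeakPartial_fnL i)
      (ha.mono_exponent le_top) ((ha' i).mono_exponent le_top) hw (hw' i))
  simp only [L2.inner_eq_integral]
  rw [← integral_finsetSum _ fun i _ => (Lp.memLp _).integrable_mul (Lp.memLp _),
    ← integral_add ((Lp.memLp _).integrable_mul (Lp.memLp _))
      (integrable_finsetSum _ fun i _ => (Lp.memLp _).integrable_mul (Lp.memLp _)), ← h1]
  refine integral_congr_ae ?_
  filter_upwards [coeFn_divGrad ha ha' u, coeFn_mulL ha (H2.dL 0 u), coeFn_mulL ha (H2.dL 1 u)]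
    with x h1 h2 h3
  have e : ∀ i, u.d i = H2.dL i u := fun i => rfl
  simp only [Fin.sum_univ_two, h1, h2, h3, Pi.add_apply, e]
  ring

end DivGrad

theorem MemLp.idApprox {f : Plane → ℝ} (hf : MemLp f 2 (volume.restrict Ω)) (k : ℕ) :
    MemLp (fun x => BonaSmith.idApprox k (f x)) 2 (volume.restrict Ω) :=
  hf.mono ((contDiff_idApprox k).continuous.comp_aestronglyMeasurable hf.1)
    (Eventually.of_forall fun _ => abs_idApprox_le k _)

theorem MemLp.deriv_idApprox_mul {f f' : Plane → ℝ} (hf : MemLp f 2 (volume.restrict Ω))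
    (hf' : MemLp f' 2 (volume.restrict Ω)) (k : ℕ) :
    MemLp (fun x => deriv (BonaSmith.idApprox k) (f x) * f' x) 2 (volume.restrict Ω) :=
  hf'.mono ((((contDiff_idApprox k).continuous_deriv le_rfl).comp_aestronglyMeasurable hf.1).mul
    hf'.1) (Eventually.of_forall fun x => by
      rw [norm_mul]
      exact mul_le_of_le_one_left (norm_nonneg _) (abs_deriv_idApprox_le k _))

theorem MemLp.idApprox_top {f : Plane → ℝ} (hf : MemLp f 2 (volume.restrict Ω)) (k : ℕ) :
    MemLp (fun x => BonaSmith.idApprox k (f x)) ∞ (volume.restrict Ω) :=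
  memLp_top_of_bound ((contDiff_idApprox k).continuous.comp_aestronglyMeasurable hf.1) (k + 1)
    (Eventually.of_forall fun _ => abs_idApprox_le' k _)

/-- If `V` has vanishing normal trace and `∇·(NV) ∈ L²(Ω)`, then `NV` has vanishing normal trace,
tested against those `w` for which `NV·∇w` is integrable. -/
theorem ZeroNormalTrace.mul_integral_eq_zero (hΩ : IsOpen Ω) {V W N' w' : Fin 2 → Plane → ℝ}
    {N w m : Plane → ℝ} (hV : ZeroNormalTrace Ω V)
    (hVW : ∀ i, HasWeakPartial Ω i (V i) (W i)) (hW : ∀ i, MemLp (W i) 2 (volume.restrict Ω))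
    (hN : MemLp N 2 (volume.restrict Ω)) (hN' : ∀ i, MemLp (N' i) 2 (volume.restrict Ω))
    (hNN' : ∀ i, HasWeakPartial Ω i N (N' i))
    (hw : MemLp w 2 (volume.restrict Ω)) (hw' : ∀ i, MemLp (w' i) 2 (volume.restrict Ω))
    (hww' : ∀ i, HasWeakPartial Ω i w (w' i))
    (hm : MemLp m 2 (volume.restrict Ω)) (hdiv : HasWeakDiv Ω (fun i x => N x * V i x) m)
    (hint : ∀ i, IntegrableOn (fun x => N x * V i x * w' i x) Ω) :
    ∫ x in Ω, (m x * w x + ∑ i, N x * V i x * w' i x) = 0 := by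
  have hV2 := hV.1
  have hm0 : m =ᵐ[volume.restrict Ω] fun x => ∑ i, (N' i x * V i x + N x * W i x) :=
    hdiv.unique hΩ (HasWeakDiv.of_hasWeakPartial fun i =>
      (hNN' i).mul hΩ (hVW i) hN (hN' i) (hV2 i) (hW i))
  -- Truncate `w` at level `j` and, inside, `N` at level `k`: the product of the two truncations is
  -- an admissible test function for `V`. The limit `k → ∞` is taken with `j` fixed.
  have hstep : ∀ j, ∫ x in Ω, (m x * idApprox j (w x) +
      ∑ i, N x * V i x * (deriv (idApprox j) (w x) * w' i x)) = 0 := by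
    intro j
    have hwj := MemLp.idApprox hw j
    have hwj' := fun i => MemLp.deriv_idApprox_mul hw (hw' i) j
    have hk : ∀ k, ∫ x in Ω, ((∑ i, W i x) * (idApprox k (N x) * idApprox j (w x)) +
        ∑ i, V i x * (deriv (idApprox k) (N x) * N' i x * idApprox j (w x) +
          idApprox k (N x) * (deriv (idApprox j) (w x) * w' i x))) = 0 := by
      intro k
      have hNk := MemLp.idApprox hN k
      have hNk' := fun i => MemLp.deriv_idApprox_mul hN (hN' i) k
      refine hV.integral_eq_zero hΩ (HasWeakDiv.of_hasWeakPartial hVW)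
        (MemLp.mul_top_left (MemLp.idApprox_top hN k) hwj) (fun i => ?_)
        (fun i => ((hNN' i).idApprox hΩ k).mul hΩ ((hww' i).idApprox hΩ j) hNk (hNk' i) hwj
          (hwj' i))
      refine MemLp.add ?_ (MemLp.mul_top_left (MemLp.idApprox_top hN k) (hwj' i))
      simpa only [mul_comm] using MemLp.mul_top_left (MemLp.idApprox_top hw j) (hNk' i)
    have hlim : Tendsto (fun k => ∫ x in Ω, ((∑ i, W i x) * (idApprox k (N x) * idApprox j (w x)) +
        ∑ i, V i x * (deriv (idApprox k) (N x) * N' i x * idApprox j (w x) +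
          idApprox k (N x) * (deriv (idApprox j) (w x) * w' i x)))) atTop
        (𝓝 (∫ x in Ω, ((∑ i, W i x) * (N x * idApprox j (w x)) +
        ∑ i, V i x * (1 * N' i x * idApprox j (w x) +
          N x * (deriv (idApprox j) (w x) * w' i x))))) := by
      -- The truncation of `N` is bounded by `|N|` with slope at most one; the truncation of `w` is
      -- bounded by `j + 1`. Only the last term, containing `∇w`, needs `hint`.
      refine tendsto_integral_of_dominated_convergence
        (fun x => (∑ i, |W i x * N x|) * (j + 1) +
          ∑ i, (|V i x * N' i x| * (j + 1) + |N x * V i x * w' i x|)) (fun k => ?_) ?_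
        (fun k => Eventually.of_forall fun x => ?_) (Eventually.of_forall fun x => ?_)
      · have hNk := (MemLp.idApprox hN k).1
        have hNk' := fun i => (MemLp.deriv_idApprox_mul hN (hN' i) k).1
        have hW0 := fun i => (hW i).1
        have hV0 := fun i => (hV2 i).1
        have hj0 := hwj.1
        have hj1 := fun i => (hwj' i).1
        refine ((Finset.aestronglyMeasurable_fun_sum _ fun i _ => hW0 i).mul (hNk.mul hj0)).add
          (Finset.aestronglyMeasurable_fun_sum _ fun i _ => (hV0 i).mul
            (((hNk' i).mul hj0).add (hNk.mul (hj1 i))))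
      · refine Integrable.add (Integrable.mul_const (integrable_finsetSum _ fun i _ =>
          ((hW i).integrable_mul hN).abs) _) (integrable_finsetSum _ fun i _ => ?_)
        exact (((hV2 i).integrable_mul (hN' i)).abs.mul_const _).add (hint i).abs
      · have hN1 := abs_idApprox_le k (N x)
        have hN2 := abs_deriv_idApprox_le k (N x)
        have hw1 := abs_idApprox_le' j (w x)
        have hw2 := abs_deriv_idApprox_le j (w x)
        have hj : (0 : ℝ) ≤ j + 1 := by positivity
        refine (norm_add_le _ _).trans (add_le_add ?_ ((norm_sum_le _ _).trans
          (Finset.sum_le_sum fun i _ => ?_)))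
        · rw [← mul_assoc, norm_mul, Finset.sum_mul]
          refine mul_le_mul ((norm_sum_le _ _).trans (Finset.sum_le_sum fun i _ => ?_)) hw1
            (norm_nonneg _) (Finset.sum_nonneg fun i _ => abs_nonneg _)
          rw [norm_mul, abs_mul]
          exact mul_le_mul_of_nonneg_left hN1 (norm_nonneg _)
        · rw [mul_add]
          refine (norm_add_le _ _).trans (add_le_add ?_ ?_)
          · rw [← mul_assoc, norm_mul]
            refine mul_le_mul ?_ hw1 (norm_nonneg _) (abs_nonneg _)
            rw [norm_mul, norm_mul, abs_mul]
            exact mul_le_mul_of_nonneg_left (mul_le_of_le_one_left (norm_nonneg _) hN2)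
              (norm_nonneg _)
          · rw [norm_mul, norm_mul, norm_mul, abs_mul, abs_mul, mul_comm |N x|, mul_assoc]
            refine mul_le_mul_of_nonneg_left ?_ (norm_nonneg _)
            exact mul_le_mul hN1 (mul_le_of_le_one_left (norm_nonneg _) hw2)
              (by positivity) (abs_nonneg _)
      · have hN1 := tendsto_idApprox (N x)
        have hN2 := tendsto_deriv_idApprox (N x)
        exact ((hN1.mul_const _).const_mul _).add (tendsto_finsetSum _ fun i _ =>
          (((hN2.mul_const _).mul_const _).add (hN1.mul_const _)).const_mul _)
    simp only [hk] at hlim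
    -- In the limit the coefficient of the truncated `w` is `∑ (N' V + N W)`, which is `m` by the
    -- product rule.
    rw [tendsto_nhds_unique tendsto_const_nhds hlim]
    refine integral_congr_ae ?_
    filter_upwards [hm0] with x hx
    rw [hx]
    simp only [Fin.sum_univ_two]
    ring
  have hlim : Tendsto (fun j => ∫ x in Ω, (m x * idApprox j (w x) +
      ∑ i, N x * V i x * (deriv (idApprox j) (w x) * w' i x))) atTop
      (𝓝 (∫ x in Ω, (m x * w x + ∑ i, N x * V i x * (1 * w' i x)))) := by
    refine tendsto_integral_of_dominated_convergence
      (fun x => |m x * w x| + ∑ i, |N x * V i x * w' i x|) (fun j => ?_) ?_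
      (fun j => Eventually.of_forall fun x => ?_) (Eventually.of_forall fun x => ?_)
    · exact (hm.1.mul (MemLp.idApprox hw j).1).add (Finset.aestronglyMeasurable_fun_sum _ fun i _ =>
        (hN.1.mul (hV2 i).1).mul (MemLp.deriv_idApprox_mul hw (hw' i) j).1)
    · exact (hm.integrable_mul hw).abs.add (integrable_finsetSum _ fun i _ => (hint i).abs)
    · refine (norm_add_le _ _).trans (add_le_add ?_ ((norm_sum_le _ _).trans
          (Finset.sum_le_sum fun i _ => ?_)))
      · rw [norm_mul, abs_mul]
        exact mul_le_mul_of_nonneg_left (abs_idApprox_le j _) (norm_nonneg _)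
      · rw [norm_mul, norm_mul _ (w' i x), abs_mul _ (w' i x)]
        exact mul_le_mul_of_nonneg_left (mul_le_of_le_one_left (norm_nonneg _)
          (abs_deriv_idApprox_le j _)) (norm_nonneg _)
    · exact ((tendsto_idApprox (w x)).const_mul _).add (tendsto_finsetSum _ fun i _ =>
          ((tendsto_deriv_idApprox (w x)).mul_const _).const_mul _)
  simp only [hstep] at hlim
  simpa only [one_mul] using (tendsto_nhds_unique tendsto_const_nhds hlim).symm

end BonaSmith

/-! ### The kinetic energy along a solution and its time derivative. -/

namespace BonaSmith

open Filter Topology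

variable {Ω : Set Plane}

/-- Pairing of a strongly convergent family with a bounded family that converges weakly against
bounded functions. -/
theorem tendsto_inner_of_tendsto_bounded {ι : Type*} {l : Filter ι} {e P : ι → L2 Ω} {e₀ Q : L2 Ω}
    (he : Tendsto e l (𝓝 e₀)) {C : ℝ} (hP : ∀ᶠ s in l, ‖P s‖ ≤ C)
    (hweak : ∀ (a : Plane → ℝ) (_ : MemLp a ∞ (volume.restrict Ω))
      (ha : MemLp a 2 (volume.restrict Ω)),
      Tendsto (fun s => inner ℝ (ha.toLp a) (P s)) l (𝓝 (inner ℝ (ha.toLp a) Q))) :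
    Tendsto (fun s => inner ℝ (e s) (P s)) l (𝓝 (inner ℝ e₀ Q)) := by
  have h1 : Tendsto (fun s => inner ℝ (e s - e₀) (P s)) l (𝓝 0) := by
    refine squeeze_zero_norm' (a := fun s => ‖e s - e₀‖ * C) ?_ ?_
    · filter_upwards [hP] with s hs
      exact (norm_inner_le_norm _ _).trans (mul_le_mul_of_nonneg_left hs (norm_nonneg _))
    · simpa using (tendsto_iff_norm_sub_tendsto_zero.1 he).mul_const C
  have h2 : Tendsto (fun s => inner ℝ e₀ (P s)) l (𝓝 (inner ℝ e₀ Q)) := by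
    rw [Metric.tendsto_nhds]
    intro ε hε
    set B := |C| + ‖Q‖ + 1 with hB
    have hB0 : 0 < B := by positivity
    -- Simple functions are bounded and dense in `L²`. Since `B` bounds `‖P s - Q‖`, an error of `ε
    -- / (2B)` in `e₀` costs at most `ε / 2`.
    obtain ⟨a, ha, ha2⟩ := (Lp.memLp e₀).exists_simpleFunc_eLpNorm_sub_lt (by norm_num)
      (ε := ENNReal.ofReal (ε / (2 * B))) (by simpa using by positivity)
    have hdist : ‖e₀ - ha2.toLp a‖ < ε / (2 * B) := by
      have : e₀ - ha2.toLp a = ((Lp.memLp e₀).sub ha2).toLp (⇑e₀ - ⇑a) := by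
        rw [MemLp.toLp_sub (Lp.memLp e₀) ha2, Lp.toLp_coeFn]
      rw [this, Lp.norm_toLp]
      exact ENNReal.toReal_lt_of_lt_ofReal ha
    have hatop : MemLp a ∞ (volume.restrict Ω) := SimpleFunc.memLp_top a _
    filter_upwards [hP, (Metric.tendsto_nhds.1 (hweak a hatop ha2)) (ε / 2) (by positivity)]
      with s hs hs'
    rw [Real.dist_eq] at hs' ⊢
    have hsplit : inner ℝ e₀ (P s) - inner ℝ e₀ Q = inner ℝ (e₀ - ha2.toLp a) (P s - Q) +
        (inner ℝ (ha2.toLp a) (P s) - inner ℝ (ha2.toLp a) Q) := by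
      rw [← inner_sub_right, ← inner_sub_right, inner_sub_left]
      ring
    have hn : ‖P s - Q‖ ≤ B := by
      refine (norm_sub_le _ _).trans ?_
      have := hs.trans (le_abs_self C)
      rw [hB]
      linarith
    have h3 : |inner ℝ (e₀ - ha2.toLp a) (P s - Q)| ≤ ε / 2 := by
      refine (abs_real_inner_le_norm _ _).trans ?_
      calc ‖e₀ - ha2.toLp a‖ * ‖P s - Q‖ ≤ ε / (2 * B) * B :=
            mul_le_mul hdist.le hn (norm_nonneg _) (by positivity)
        _ = ε / 2 := by field_simp
    rw [hsplit]
    refine (abs_add_le _ _).trans_lt ?_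
    linarith
  have := h1.add h2
  rw [zero_add] at this
  refine this.congr fun s => ?_
  rw [← inner_add_left, sub_add_cancel]

theorem integrable_mul_of_memLp_two {f g : Plane → ℝ} (hf : MemLp f 2 (volume.restrict Ω))
    (hg : MemLp g 2 (volume.restrict Ω)) :
    Integrable (fun x => f x * g x) (volume.restrict Ω) :=
  hf.integrable_mul hg

theorem memLp_mul_of_sum_sq {u v : Fin 2 → L2 Ω}
    (hu : MemLp (fun x => ∑ i, u i x ^ 2) 2 (volume.restrict Ω))
    (hv : MemLp (fun x => ∑ i, v i x ^ 2) 2 (volume.restrict Ω)) (i : Fin 2) :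
    MemLp (fun x => u i x * v i x) 2 (volume.restrict Ω) := by
  refine (hu.add hv).mono ((Lp.aestronglyMeasurable _).mul (Lp.aestronglyMeasurable _))
    (Eventually.of_forall fun x => ?_)
  have h1 : u i x ^ 2 ≤ ∑ j, u j x ^ 2 :=
    Finset.single_le_sum (f := fun j => u j x ^ 2) (fun j _ => sq_nonneg _) (Finset.mem_univ i)
  have h2 : v i x ^ 2 ≤ ∑ j, v j x ^ 2 :=
    Finset.single_le_sum (f := fun j => v j x ^ 2) (fun j _ => sq_nonneg _) (Finset.mem_univ i)
  refine le_trans ?_ (le_abs_self _)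
  rw [Real.norm_eq_abs, abs_le, Pi.add_apply]
  constructor <;> nlinarith [sq_nonneg (u i x + v i x), sq_nonneg (u i x - v i x)]

theorem HasWeakDiv.congr_ae {V : Fin 2 → Plane → ℝ} {m n : Plane → ℝ} (h : HasWeakDiv Ω V m)
    (hmn : m =ᵐ[volume.restrict Ω] n) : HasWeakDiv Ω V n :=
  ⟨h.locInt, locallyIntegrableOn_congr_ae h.locInt' hmn, fun ψ hψ => (h.eq ψ hψ).trans
    (congrArg Neg.neg (integral_congr_ae (hmn.mul (ae_eq_refl ψ))))⟩

theorem hasDerivWithinAt_derivWithin {η : ℝ → H2 Ω} {T t : ℝ} (h : ContDiffOn ℝ 1 η (Icc 0 T))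
    (ht : t ∈ Icc 0 T) : HasDerivWithinAt η (derivWithin η (Icc 0 T) t) (Icc 0 T) t :=
  (h.differentiableOn (by simp) t ht).hasDerivWithinAt

section Solution

variable {D : Plane → ℝ} {D' : Fin 2 → Plane → ℝ} {g b c T : ℝ} {η₀ φ₀ : H2 Ω} {η φ : ℝ → H2 Ω}

theorem memLp_top_sq (hD : MemLp D ∞ (volume.restrict Ω)) :
    MemLp (fun x => D x ^ 2) ∞ (volume.restrict Ω) := by
  simpa only [sq] using MemLp.mul' (p := ∞) (q := ∞) hD hD

theorem memLp_top_sq' (hD : MemLp D ∞ (volume.restrict Ω))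
    (hD' : ∀ i, MemLp (D' i) ∞ (volume.restrict Ω)) (i : Fin 2) :
    MemLp (fun x => 2 * D x * D' i x) ∞ (volume.restrict Ω) := by
  simpa only [mul_assoc] using (MemLp.mul' (p := ∞) (q := ∞) (r := ∞) (hD' i) hD).const_mul 2

/-- The operator `u ↦ ∇·(D²∇u)` on `H²(Ω)`. -/
noncomputable def divSqGrad (hD : MemLp D ∞ (volume.restrict Ω))
    (hD' : ∀ i, MemLp (D' i) ∞ (volume.restrict Ω)) : H2 Ω →L[ℝ] L2 Ω :=
  divGrad (memLp_top_sq hD) (memLp_top_sq' hD hD')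

variable [IsFiniteMeasure (volume.restrict Ω)] (hΩ : IsOpen Ω)
  (hD : MemLp D ∞ (volume.restrict Ω)) (hD' : ∀ i, MemLp (D' i) ∞ (volume.restrict Ω))
  (hDD' : ∀ i, HasWeakPartial Ω i D (D' i))

include hΩ hD hD' hDD' in
theorem hasWeakPartial_sq (i : Fin 2) :
    HasWeakPartial Ω i (fun x => D x ^ 2) (fun x => 2 * D x * D' i x) :=
  (hDD' i).sq hΩ (hD.mono_exponent le_top) ((hD' i).mono_exponent le_top)

/-- The weak divergence `∇·[(D+η)∇φ]` prescribed by the mass equation. -/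
noncomputable def massDiv (b T : ℝ) (η : ℝ → H2 Ω) (t : ℝ) : L2 Ω :=
  b • divSqGrad hD hD' (derivWithin η (Icc 0 T) t) - H2.fnL (derivWithin η (Icc 0 T) t)

/-- The square `|∇φ|²` of the velocity prescribed by the momentum equation. -/
noncomputable def sqVelocity (g b c T : ℝ) (η φ : ℝ → H2 Ω) (t : ℝ) : L2 Ω :=
  (2 : ℝ) • (b • divSqGrad hD hD' (derivWithin φ (Icc 0 T) t) + (c * g) • divSqGrad hD hD' (η t)
    - g • H2.fnL (η t) - H2.fnL (derivWithin φ (Icc 0 T) t))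

include hΩ hDD' in
theorem IsPotentialSolution.hasWeakDiv_massDiv
    (h : IsPotentialSolution Ω D g b c T η₀ φ₀ η φ) {t : ℝ} (ht : t ∈ Icc 0 T) :
    HasWeakDiv Ω (fun i x => (D x + H2.fnL (η t) x) * H2.dL i (φ t) x)
      (massDiv hD hD' b T η t) := by
  obtain ⟨m, n, hm, hn, hmn⟩ := h.mass t ht
  refine HasWeakDiv.congr_ae hm ?_
  have hn' := hn.unique hΩ (hasWeakDiv_divGrad (memLp_top_sq hD) (memLp_top_sq' hD hD') hΩ
    (hasWeakPartial_sq hΩ hD hD' hDD') (derivWithin η (Icc 0 T) t))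
  filter_upwards [hmn, hn', Lp.coeFn_sub (b • divSqGrad hD hD' (derivWithin η (Icc 0 T) t))
    (H2.fnL (derivWithin η (Icc 0 T) t)),
    Lp.coeFn_smul b (divSqGrad hD hD' (derivWithin η (Icc 0 T) t))] with x h1 h2 h3 h4
  rw [massDiv, h3, Pi.sub_apply, h4, Pi.smul_apply, divSqGrad, ← h2, smul_eq_mul]
  have : (derivWithin η (Icc 0 T) t).fn x = H2.fnL (derivWithin η (Icc 0 T) t) x := rfl
  linarith

include hΩ hDD' in
-- Solving the momentum equation for `|∇φ|²` leaves only `L²` terms. This is the source of the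
-- integrability of `|∇φ|²` and of its square.
theorem IsPotentialSolution.sqVelocity_ae
    (h : IsPotentialSolution Ω D g b c T η₀ φ₀ η φ) {t : ℝ} (ht : t ∈ Icc 0 T) :
    sqVelocity hD hD' g b c T η φ t =ᵐ[volume.restrict Ω]
      fun x => ∑ i, H2.dL i (φ t) x ^ 2 := by
  obtain ⟨m, n, hm, hn, hmn⟩ := h.momentum t ht
  have hm' := hm.unique hΩ (hasWeakDiv_divGrad (memLp_top_sq hD) (memLp_top_sq' hD hD') hΩ
    (hasWeakPartial_sq hΩ hD hD' hDD') (η t))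
  have hn' := hn.unique hΩ (hasWeakDiv_divGrad (memLp_top_sq hD) (memLp_top_sq' hD hD') hΩ
    (hasWeakPartial_sq hΩ hD hD' hDD') (derivWithin φ (Icc 0 T) t))
  set u := derivWithin φ (Icc 0 T) t
  set Au := divSqGrad hD hD' u with hAu
  set Aη := divSqGrad hD hD' (η t) with hAη
  filter_upwards [hmn, hm', hn', Lp.coeFn_smul (2 : ℝ) (b • Au + (c * g) • Aη
    - g • H2.fnL (η t) - H2.fnL u), Lp.coeFn_sub (b • Au + (c * g) • Aη - g • H2.fnL (η t))
    (H2.fnL u), Lp.coeFn_sub (b • Au + (c * g) • Aη) (g • H2.fnL (η t)),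
    Lp.coeFn_add (b • Au) ((c * g) • Aη), Lp.coeFn_smul b Au, Lp.coeFn_smul (c * g) Aη,
    Lp.coeFn_smul g (H2.fnL (η t))] with x h1 h2 h3 h4 h5 h6 h7 h8 h9 h10
  rw [sqVelocity, h4, Pi.smul_apply, h5, Pi.sub_apply, h6, Pi.sub_apply, h7, Pi.add_apply, h8, h9,
    h10, hAu, hAη, Pi.smul_apply, Pi.smul_apply, Pi.smul_apply, divSqGrad, ← h2, ← h3]
  simp only [smul_eq_mul]
  have e1 : u.fn x = H2.fnL u x := rfl
  have e2 : (η t).fn x = H2.fnL (η t) x := rfl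
  have e3 : ∀ i, (φ t).d i x = H2.dL i (φ t) x := fun i => rfl
  simp only [e1, e2, e3] at h1
  linarith

omit [IsFiniteMeasure (volume.restrict Ω)] in
theorem continuousOn_massDiv (h : IsPotentialSolution Ω D g b c T η₀ φ₀ η φ) (hT : 0 < T) :
    ContinuousOn (massDiv hD hD' b T η) (Icc 0 T) := by
  have h1 := h.regη.continuousOn_derivWithin (uniqueDiffOn_Icc hT) le_rfl
  exact (((divSqGrad hD hD').continuous.comp_continuousOn h1).const_smul b).sub
    (H2.fnL.continuous.comp_continuousOn h1)

omit [IsFiniteMeasure (volume.restrict Ω)] in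
-- The formula is a fixed bounded linear expression in `η` and `φ_t`, so `|∇φ|²` inherits continuity
-- in time with values in `L²` from the `C¹` regularity of the curves.
theorem continuousOn_sqVelocity (h : IsPotentialSolution Ω D g b c T η₀ φ₀ η φ) (hT : 0 < T) :
    ContinuousOn (sqVelocity hD hD' g b c T η φ) (Icc 0 T) := by
  have h1 := h.regφ.continuousOn_derivWithin (uniqueDiffOn_Icc hT) le_rfl
  have h2 := h.regη.continuousOn
  have hA := (divSqGrad hD hD').continuous
  have hf := (H2.fnL (Ω := Ω)).continuous
  exact ((((hA.comp_continuousOn h1).const_smul b).add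
    ((hA.comp_continuousOn h2).const_smul (c * g))).sub ((hf.comp_continuousOn h2).const_smul g)).sub
    (hf.comp_continuousOn h1) |>.const_smul (2 : ℝ)

include hΩ hDD' hD hD' in
theorem IsPotentialSolution.memLp_sq (h : IsPotentialSolution Ω D g b c T η₀ φ₀ η φ) {t : ℝ}
    (ht : t ∈ Icc 0 T) : MemLp (fun x => ∑ i, H2.dL i (φ t) x ^ 2) 2 (volume.restrict Ω) :=
  (memLp_congr_ae (h.sqVelocity_ae hΩ hD hD' hDD' ht)).1 (Lp.memLp _)

include hD in
theorem memLp_depth (u : H2 Ω) : MemLp (fun x => D x + H2.fnL u x) 2 (volume.restrict Ω) :=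
  (hD.mono_exponent le_top).add (Lp.memLp _)

include hΩ hDD' in
-- Green's formula for the flux `(D+η)∇φ`. The condition on `w` makes `(D+η)∇φ·∇w` a product of two
-- `L²` functions; it holds for differences of values of `φ`, the only use made of it.
theorem IsPotentialSolution.inner_massDiv (h : IsPotentialSolution Ω D g b c T η₀ φ₀ η φ) {t : ℝ}
    (ht : t ∈ Icc 0 T) {w : H2 Ω}
    (hw : ∀ i, MemLp (fun x => H2.dL i (φ t) x * H2.dL i w x) 2 (volume.restrict Ω)) :
    ∫ x in Ω, ∑ i, (D x + H2.fnL (η t) x) * (H2.dL i (φ t) x * H2.dL i w x) =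
      -inner ℝ (massDiv hD hD' b T η t) (H2.fnL w) := by
  have hN := memLp_depth hD (η t)
  have hint : ∀ i, IntegrableOn
      (fun x => (D x + H2.fnL (η t) x) * (H2.dL i (φ t) x * H2.dL i w x)) Ω := fun i =>
    integrable_mul_of_memLp_two hN (hw i)
  have key := ZeroNormalTrace.mul_integral_eq_zero hΩ (h.bcφ t ht)
    (W := fun i => H2.ddL i i (φ t)) (N := fun x => D x + H2.fnL (η t) x)
    (N' := fun i x => D' i x + H2.dL i (η t) x) (w := H2.fnL w) (w' := fun i => H2.dL i w)
    (fun i => (φ t).hasWeakPartial_dL i i) (fun i => Lp.memLp _) hN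
    (fun i => ((hD' i).mono_exponent le_top).add (Lp.memLp _))
    (fun i => (hDD' i).add_fun ((η t).hasWeakPartial_fnL i)) (Lp.memLp _) (fun i => Lp.memLp _)
    w.hasWeakPartial_fnL (Lp.memLp _) (h.hasWeakDiv_massDiv hΩ hD hD' hDD' ht) (fun i => by
      simp only [mul_assoc]
      exact hint i)
  have e : ∀ i, (φ t).d i = H2.dL i (φ t) := fun i => rfl
  simp only [mul_assoc, e] at key
  rw [integral_add (integrable_mul_of_memLp_two (Lp.memLp _) (Lp.memLp _))
    (integrable_finsetSum _ fun i _ => hint i)] at key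
  rw [L2.inner_eq_integral]
  linarith

include hΩ hDD' in
/-- The increment of `∫ (D+η)|∇φ|²` between two times. -/
theorem IsPotentialSolution.kinetic_sub (h : IsPotentialSolution Ω D g b c T η₀ φ₀ η φ) {s t : ℝ}
    (hs : s ∈ Icc 0 T) (ht : t ∈ Icc 0 T) :
    (∫ x in Ω, (D x + H2.fnL (η s) x) * ∑ i, H2.dL i (φ s) x ^ 2) -
        ∫ x in Ω, (D x + H2.fnL (η t) x) * ∑ i, H2.dL i (φ t) x ^ 2 =
      -inner ℝ (massDiv hD hD' b T η s) (H2.fnL (φ s - φ t))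
        - inner ℝ (massDiv hD hD' b T η t) (H2.fnL (φ s - φ t))
        + ∫ x in Ω, H2.fnL (η s - η t) x * ∑ i, H2.dL i (φ s) x * H2.dL i (φ t) x := by
  have qs := h.memLp_sq hΩ hD hD' hDD' hs
  have qt := h.memLp_sq hΩ hD hD' hDD' ht
  have hss := memLp_mul_of_sum_sq (u := fun i => H2.dL i (φ s)) (v := fun i => H2.dL i (φ s)) qs qs
  have hst := memLp_mul_of_sum_sq (u := fun i => H2.dL i (φ s)) (v := fun i => H2.dL i (φ t)) qs qt
  have hts := memLp_mul_of_sum_sq (u := fun i => H2.dL i (φ t)) (v := fun i => H2.dL i (φ s)) qt qs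
  have htt := memLp_mul_of_sum_sq (u := fun i => H2.dL i (φ t)) (v := fun i => H2.dL i (φ t)) qt qt
  have hδ : ∀ i, H2.dL i (φ s - φ t) =ᵐ[volume.restrict Ω]
      fun x => H2.dL i (φ s) x - H2.dL i (φ t) x := fun i => by
    rw [map_sub]
    exact Lp.coeFn_sub _ _
  have hη : H2.fnL (η s - η t) =ᵐ[volume.restrict Ω]
      fun x => H2.fnL (η s) x - H2.fnL (η t) x := by
    rw [map_sub]
    exact Lp.coeFn_sub _ _
  have hws : ∀ i, MemLp (fun x => H2.dL i (φ s) x * H2.dL i (φ s - φ t) x) 2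
      (volume.restrict Ω) := fun i => by
    refine ((hss i).sub (hst i)).ae_eq ?_
    filter_upwards [hδ i] with x hx
    rw [hx, Pi.sub_apply, mul_sub]
  have hwt : ∀ i, MemLp (fun x => H2.dL i (φ t) x * H2.dL i (φ s - φ t) x) 2
      (volume.restrict Ω) := fun i => by
    refine ((hts i).sub (htt i)).ae_eq ?_
    filter_upwards [hδ i] with x hx
    rw [hx, Pi.sub_apply, mul_sub]
  rw [← h.inner_massDiv hΩ hD hD' hDD' hs hws, sub_eq_add_neg (∫ x in Ω, _) (inner ℝ _ _),
    ← h.inner_massDiv hΩ hD hD' hDD' ht hwt]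
  have hNs := memLp_depth hD (η s)
  have hNt := memLp_depth hD (η t)
  rw [← integral_sub (integrable_mul_of_memLp_two hNs qs) (integrable_mul_of_memLp_two hNt qt),
    ← integral_add (integrable_finsetSum _ fun i _ => integrable_mul_of_memLp_two hNs (hws i))
      (integrable_finsetSum _ fun i _ => integrable_mul_of_memLp_two hNt (hwt i)), ← integral_add]
  -- With `N = D + η` and `v = ∇φ`, the identity is `N_s|v_s|² - N_t|v_t|² = N_s v_s·(v_s - v_t) +
  -- N_t v_t·(v_s - v_t) + (N_s - N_t) v_s·v_t`.
  · refine integral_congr_ae ?_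
    filter_upwards [hδ 0, hδ 1, hη] with x h0 h1 h2
    simp only [Fin.sum_univ_two, h0, h1, h2]
    ring
  · exact (integrable_finsetSum _ fun i _ => integrable_mul_of_memLp_two hNs (hws i)).add
      (integrable_finsetSum _ fun i _ => integrable_mul_of_memLp_two hNt (hwt i))
  · exact integrable_mul_of_memLp_two (Lp.memLp _) (memLp_finsetSum _ fun i _ => hst i)

include hΩ hDD' in
theorem IsPotentialSolution.hasDerivWithinAt_kinetic
    (h : IsPotentialSolution Ω D g b c T η₀ φ₀ η φ) (hT : 0 < T) {t : ℝ} (ht : t ∈ Icc 0 T) :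
    HasDerivWithinAt (fun s => ∫ x in Ω, (D x + H2.fnL (η s) x) * ∑ i, H2.dL i (φ s) x ^ 2)
      (-2 * inner ℝ (massDiv hD hD' b T η t) (H2.fnL (derivWithin φ (Icc 0 T) t)) +
        inner ℝ (H2.fnL (derivWithin η (Icc 0 T) t)) (sqVelocity hD hD' g b c T η φ t))
      (Icc 0 T) t := by
  rw [hasDerivWithinAt_iff_tendsto_slope]
  set l := 𝓝[Icc 0 T \ {t}] t with hl
  have hle : l ≤ 𝓝[Icc 0 T] t := nhdsWithin_mono _ sdiff_subset
  have hIcc : ∀ᶠ s in l, s ∈ Icc 0 T := hle self_mem_nhdsWithin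
  have hη := hasDerivWithinAt_derivWithin h.regη ht
  have hφ := hasDerivWithinAt_derivWithin h.regφ ht
  have hηs : Tendsto (fun s => H2.fnL (slope η t s)) l
      (𝓝 (H2.fnL (derivWithin η (Icc 0 T) t))) :=
    (H2.fnL.continuous.tendsto _).comp (hasDerivWithinAt_iff_tendsto_slope.1 hη)
  have hφs : Tendsto (fun s => H2.fnL (slope φ t s)) l
      (𝓝 (H2.fnL (derivWithin φ (Icc 0 T) t))) :=
    (H2.fnL.continuous.tendsto _).comp (hasDerivWithinAt_iff_tendsto_slope.1 hφ)
  have hM := (continuousOn_massDiv hD hD' h hT t ht).tendsto.mono_left hle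
  have hQ := (continuousOn_sqVelocity hD hD' h hT t ht).tendsto.mono_left hle
  have hprod : ∀ s ∈ Icc 0 T, MemLp (fun x => ∑ i, H2.dL i (φ s) x * H2.dL i (φ t) x) 2
      (volume.restrict Ω) := fun s hs => memLp_finsetSum _ fun i _ =>
    memLp_mul_of_sum_sq (u := fun i => H2.dL i (φ s)) (v := fun i => H2.dL i (φ t))
      (h.memLp_sq hΩ hD hD' hDD' hs) (h.memLp_sq hΩ hD hD' hDD' ht) i
  have hex : ∀ s ∈ Icc 0 T, ∃ P : L2 Ω, P =ᵐ[volume.restrict Ω]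
      fun x => ∑ i, H2.dL i (φ s) x * H2.dL i (φ t) x := fun s hs =>
    ⟨(hprod s hs).toLp _, (hprod s hs).coeFn_toLp⟩
  choose! P hP using hex
  have hQt := h.sqVelocity_ae hΩ hD hD' hDD' ht
  have hPQ : Tendsto (fun s => inner ℝ (H2.fnL (slope η t s)) (P s)) l
      (𝓝 (inner ℝ (H2.fnL (derivWithin η (Icc 0 T) t)) (sqVelocity hD hD' g b c T η φ t))) := by
    -- Pointwise `|∇φ(s)·∇φ(t)|` is at most half of `|∇φ(s)|² + |∇φ(t)|²`, whose `L²` norm tends to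
    -- that of `|∇φ(t)|²`; the `1` is slack.
    refine tendsto_inner_of_tendsto_bounded (C := ‖sqVelocity hD hD' g b c T η φ t‖ + 1) hηs ?_
      fun a ha ha2 => ?_
    · have hsum : Tendsto (fun s => ‖(2⁻¹ : ℝ) • (sqVelocity hD hD' g b c T η φ s +
          sqVelocity hD hD' g b c T η φ t)‖) l (𝓝 ‖(2⁻¹ : ℝ) • (sqVelocity hD hD' g b c T η φ t +
          sqVelocity hD hD' g b c T η φ t)‖) := ((hQ.add_const _).const_smul (2⁻¹ : ℝ)).norm
      rw [← two_smul ℝ, smul_smul, inv_mul_cancel₀ two_ne_zero, one_smul] at hsum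
      filter_upwards [hIcc, hsum.eventually (gt_mem_nhds (lt_add_one _))] with s hs hlt
      refine le_trans ?_ hlt.le
      refine Lp.norm_le_norm_of_ae_le ?_
      filter_upwards [hP s hs, hQt, h.sqVelocity_ae hΩ hD hD' hDD' hs,
        Lp.coeFn_smul (2⁻¹ : ℝ) (sqVelocity hD hD' g b c T η φ s +
          sqVelocity hD hD' g b c T η φ t), Lp.coeFn_add (sqVelocity hD hD' g b c T η φ s)
          (sqVelocity hD hD' g b c T η φ t)] with x h1 h2 h3 h4 h5
      rw [h1, h4, Pi.smul_apply, h5, Pi.add_apply, h2, h3]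
      simp only [Fin.sum_univ_two, smul_eq_mul]
      refine le_trans ?_ (le_abs_self _)
      rw [Real.norm_eq_abs, abs_le]
      constructor <;>
        nlinarith [sq_nonneg (H2.dL 0 (φ s) x + H2.dL 0 (φ t) x),
          sq_nonneg (H2.dL 0 (φ s) x - H2.dL 0 (φ t) x),
          sq_nonneg (H2.dL 1 (φ s) x + H2.dL 1 (φ t) x),
          sq_nonneg (H2.dL 1 (φ s) x - H2.dL 1 (φ t) x)]
    · have hcont : Tendsto φ l (𝓝 (φ t)) := (h.regφ.continuousOn t ht).tendsto.mono_left hle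
      -- For bounded `a` the factor can be moved onto `∇φ(t)`, leaving a pairing that is continuous
      -- in `∇φ(s)` for the `L²` norm. This yields the weak convergence.
      have key : ∀ s, ∀ R : L2 Ω, (R =ᵐ[volume.restrict Ω]
          fun x => ∑ i, H2.dL i (φ s) x * H2.dL i (φ t) x) →
          inner ℝ (ha2.toLp a) R = ∑ i, inner ℝ (H2.dL i (φ s)) (mulL ha (H2.dL i (φ t))) := by
        intro s R hR
        simp only [L2.inner_eq_integral]
        rw [← integral_finsetSum _ fun i _ => integrable_mul_of_memLp_two (Lp.memLp _) (Lp.memLp _)]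
        refine integral_congr_ae ?_
        filter_upwards [hR, ha2.coeFn_toLp, coeFn_mulL ha (H2.dL 0 (φ t)),
          coeFn_mulL ha (H2.dL 1 (φ t))] with x h1 h2 h3 h4
        simp only [Fin.sum_univ_two, h1, h2, h3, h4]
        ring
      have hlim : Tendsto (fun s => ∑ i, inner ℝ (H2.dL i (φ s)) (mulL ha (H2.dL i (φ t)))) l
          (𝓝 (∑ i, inner ℝ (H2.dL i (φ t)) (mulL ha (H2.dL i (φ t))))) :=
        tendsto_finsetSum _ fun i _ => Tendsto.inner
          (((H2.dL i).continuous.tendsto _).comp hcont) tendsto_const_nhds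
      rw [← key t _ (hQt.trans (Eventually.of_forall fun x => by simp only [sq]))] at hlim
      refine hlim.congr' ?_
      filter_upwards [hIcc] with s hs
      exact (key s _ (hP s hs)).symm
  -- The terms with `M` at time `s` and at time `t` have the same limit, by continuity of `M` in
  -- time; hence the factor `2`.
  have hfin := ((hM.inner hφs (𝕜 := ℝ)).neg.sub (hφs.inner
    (tendsto_const_nhds (x := massDiv hD hD' b T η t)) (𝕜 := ℝ))).add hPQ
  rw [real_inner_comm (massDiv hD hD' b T η t)] at hfin
  have e : ∀ A B : ℝ, -A - A + B = -2 * A + B := fun A B => by ring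
  rw [e] at hfin
  refine hfin.congr' ?_
  filter_upwards [hIcc] with s hs
  rw [slope_def_module (fun s => ∫ x in Ω, _), h.kinetic_sub hΩ hD hD' hDD' hs ht]
  have h3 : ∫ x in Ω, H2.fnL (η s - η t) x * ∑ i, H2.dL i (φ s) x * H2.dL i (φ t) x =
      inner ℝ (H2.fnL (η s - η t)) (P s) := by
    rw [L2.inner_eq_integral]
    exact integral_congr_ae ((ae_eq_refl _).mul (hP s hs).symm)
  rw [h3, slope_def_module, slope_def_module, map_smul, map_smul, real_inner_smul_right,
    real_inner_smul_left, real_inner_smul_left, real_inner_comm (massDiv hD hD' b T η t), smul_eq_mul]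
  ring

end Solution

end BonaSmith

/-! ### The energy balance and the passage to the velocity formulation. -/

namespace BonaSmith

open Filter Topology

variable {Ω : Set Plane} {D : Plane → ℝ} {D' : Fin 2 → Plane → ℝ} {g b c T : ℝ} {η₀ φ₀ : H2 Ω}
  {η φ : ℝ → H2 Ω}

theorem integral_sq_mul_sq {a : Plane → ℝ} (ha : MemLp a ∞ (volume.restrict Ω)) (f : L2 Ω) :
    IntegrableOn (fun x => a x * f x ^ 2) Ω ∧
      ∫ x in Ω, a x * f x ^ 2 = inner ℝ f (mulL ha f) := by
  have h : (fun x => f x * mulL ha f x) =ᵐ[volume.restrict Ω] fun x => a x * f x ^ 2 := by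
    filter_upwards [coeFn_mulL ha f] with x hx
    rw [hx]
    ring
  exact ⟨(integrable_mul_of_memLp_two (Lp.memLp f) (Lp.memLp (mulL ha f))).congr h,
    (integral_congr_ae h).symm.trans (L2.inner_eq_integral _ _).symm⟩

variable [IsFiniteMeasure (volume.restrict Ω)]

theorem integrableOn_potentialDensity (hD : MemLp D ∞ (volume.restrict Ω)) {u v : H2 Ω}
    (hv : MemLp (fun x => ∑ i, H2.dL i v x ^ 2) 2 (volume.restrict Ω)) :
    IntegrableOn (potentialDensity D g c u v) Ω ∧
      potentialEnergy D g c u v = 1 / 2 * (g * inner ℝ (H2.fnL u) (H2.fnL u) +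
        (∫ x in Ω, (D x + H2.fnL u x) * ∑ i, H2.dL i v x ^ 2) +
        c * g * ∑ i, inner ℝ (H2.dL i u) (mulL (memLp_top_sq hD) (H2.dL i u))) := by
  have h1 : IntegrableOn (fun x => g * (H2.fnL u x * H2.fnL u x)) Ω :=
    (integrable_mul_of_memLp_two (Lp.memLp _) (Lp.memLp _)).const_mul g
  have h2 := integrable_mul_of_memLp_two (memLp_depth hD u) hv
  have h3 : ∀ i ∈ Finset.univ, IntegrableOn (fun x => D x ^ 2 * H2.dL i u x ^ 2) Ω := fun i _ =>
    (integral_sq_mul_sq (memLp_top_sq hD) (H2.dL i u)).1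
  have h4 := (integrable_finsetSum _ h3).const_mul (c * g)
  have e : potentialDensity D g c u v = fun x => g * (H2.fnL u x * H2.fnL u x) +
      (D x + H2.fnL u x) * ∑ i, H2.dL i v x ^ 2 + c * g * ∑ i, D x ^ 2 * H2.dL i u x ^ 2 := by
    funext x
    simp only [potentialDensity, ← Finset.mul_sum]
    change g * H2.fnL u x ^ 2 + (D x + H2.fnL u x) * ∑ i, H2.dL i v x ^ 2 +
      c * g * D x ^ 2 * ∑ i, H2.dL i u x ^ 2 = _
    ring
  refine ⟨e ▸ (h1.add h2).add h4, ?_⟩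
  rw [potentialEnergy, e]
  congr 1
  refine (integral_add (h1.add h2) h4).trans ?_
  refine (congrArg (· + _) (integral_add h1 h2)).trans ?_
  rw [integral_const_mul, integral_const_mul, integral_finsetSum _ h3, L2.inner_eq_integral]
  simp only [fun i => (integral_sq_mul_sq (memLp_top_sq hD) (H2.dL i u)).2]

/-- Continuous linear functionals that vanish along a curve vanish on its velocity. -/
theorem inner_divSqGrad_derivWithin (hΩ : IsOpen Ω) (hD : MemLp D ∞ (volume.restrict Ω))
    (hD' : ∀ i, MemLp (D' i) ∞ (volume.restrict Ω)) (hDD' : ∀ i, HasWeakPartial Ω i D (D' i))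
    (hT : 0 < T) {ξ : ℝ → H2 Ω} (hξ : ContDiffOn ℝ 1 ξ (Icc 0 T))
    (hbc : ∀ t ∈ Icc 0 T, ZeroNormalTrace Ω (ξ t).d) {t : ℝ} (ht : t ∈ Icc 0 T) (w : H2 Ω) :
    inner ℝ (H2.fnL w) (divSqGrad hD hD' (derivWithin ξ (Icc 0 T) t)) +
      ∑ i, inner ℝ (H2.dL i w)
        (mulL (memLp_top_sq hD) (H2.dL i (derivWithin ξ (Icc 0 T) t))) = 0 := by
  -- The Neumann condition is given for `η` and `φ`, not for their time derivatives. Green's formula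
  -- with `w` fixed is a continuous linear condition on the curve, so differentiation carries it
  -- over.
  let F : H2 Ω →L[ℝ] ℝ := (innerSL ℝ (H2.fnL w)).comp (divSqGrad hD hD') +
    ∑ i, (innerSL ℝ (H2.dL i w)).comp ((mulL (memLp_top_sq hD)).comp (H2.dL i))
  have hF : ∀ u, F u = inner ℝ (H2.fnL w) (divSqGrad hD hD' u) +
      ∑ i, inner ℝ (H2.dL i w) (mulL (memLp_top_sq hD) (H2.dL i u)) := by
    intro u
    simp [F, Fin.sum_univ_two]
  have h1 : HasDerivWithinAt (fun s => F (ξ s)) (F (derivWithin ξ (Icc 0 T) t)) (Icc 0 T) t :=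
    F.hasFDerivAt.comp_hasDerivWithinAt t (hasDerivWithinAt_derivWithin hξ ht)
  have h2 : HasDerivWithinAt (fun s => F (ξ s)) 0 (Icc 0 T) t := by
    refine (hasDerivWithinAt_const t (Icc 0 T) (0 : ℝ)).congr_of_mem (fun s hs => ?_) ht
    rw [hF]
    exact (hbc s hs).inner_divGrad (memLp_top_sq hD) (memLp_top_sq' hD hD') hΩ
      (hasWeakPartial_sq hΩ hD hD' hDD') w
  rw [← hF]
  exact (uniqueDiffOn_Icc hT t ht).eq_deriv _ h1 h2

omit [IsFiniteMeasure (volume.restrict Ω)] in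
theorem inner_mulL_comm {a : Plane → ℝ} (ha : MemLp a ∞ (volume.restrict Ω)) (u v : L2 Ω) :
    inner ℝ u (mulL ha v) = inner ℝ v (mulL ha u) := by
  simp only [L2.inner_eq_integral]
  refine integral_congr_ae ?_
  filter_upwards [coeFn_mulL ha u, coeFn_mulL ha v] with x h1 h2
  rw [h1, h2]
  ring

theorem IsPotentialSolution.hasDerivWithinAt_potentialEnergy (hΩ : IsOpen Ω)
    (hD : MemLp D ∞ (volume.restrict Ω)) (hD' : ∀ i, MemLp (D' i) ∞ (volume.restrict Ω))
    (hDD' : ∀ i, HasWeakPartial Ω i D (D' i)) (hT : 0 < T)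
    (h : IsPotentialSolution Ω D g b c T η₀ φ₀ η φ) {t : ℝ} (ht : t ∈ Icc 0 T) :
    HasDerivWithinAt (fun s => potentialEnergy D g c (η s) (φ s)) 0 (Icc 0 T) t := by
  have hη := hasDerivWithinAt_derivWithin h.regη ht
  have hL : ∀ L : H2 Ω →L[ℝ] L2 Ω, HasDerivWithinAt (fun s => L (η s))
      (L (derivWithin η (Icc 0 T) t)) (Icc 0 T) t := fun L =>
    L.hasFDerivAt.comp_hasDerivWithinAt t hη
  have h1 := (((hL H2.fnL).inner ℝ (hL H2.fnL)).const_mul g).add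
    (h.hasDerivWithinAt_kinetic hΩ hD hD' hDD' hT ht)
  have h2 : HasDerivWithinAt
      (fun s => ∑ i, inner ℝ (H2.dL i (η s)) (mulL (memLp_top_sq hD) (H2.dL i (η s))))
      _ (Icc 0 T) t := HasDerivWithinAt.fun_sum (u := Finset.univ) fun i _ =>
    (hL (H2.dL i)).inner ℝ (hL ((mulL (memLp_top_sq hD)).comp (H2.dL i)))
  have h3 := (h1.add (h2.const_mul (c * g))).const_mul (1 / 2)
  refine (h3.congr_deriv ?_).congr_of_mem (fun s hs => ?_) ht
  · have b1 := (h.bcη t ht).inner_divGrad (memLp_top_sq hD) (memLp_top_sq' hD hD') hΩ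
      (hasWeakPartial_sq hΩ hD hD' hDD') (derivWithin η (Icc 0 T) t)
    have b2 := inner_divSqGrad_derivWithin hΩ hD hD' hDD' hT h.regη h.bcη ht
      (derivWithin φ (Icc 0 T) t)
    have b3 := inner_divSqGrad_derivWithin hΩ hD hD' hDD' hT h.regφ h.bcφ ht
      (derivWithin η (Icc 0 T) t)
    rw [massDiv, sqVelocity]
    simp only [divSqGrad, ContinuousLinearMap.comp_apply, inner_sub_left, inner_sub_right,
      inner_add_right, real_inner_smul_left, real_inner_smul_right, Fin.sum_univ_two] at b1 b2 b3 ⊢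
    set u := derivWithin η (Icc 0 T) t
    set v := derivWithin φ (Icc 0 T) t
    set A := divGrad (memLp_top_sq hD) (memLp_top_sq' hD hD')
    rw [inner_mulL_comm _ (H2.dL 0 (η t)), inner_mulL_comm _ (H2.dL 1 (η t)),
      real_inner_comm (H2.fnL u) (H2.fnL (η t)), real_inner_comm (H2.fnL v) (A u)]
    rw [inner_mulL_comm _ (H2.dL 0 v), inner_mulL_comm _ (H2.dL 1 v)] at b2
    -- Here `b1` is Green's formula for `η` against `η_t`; `b2` and `b3` are those for `η_t` against
    -- `φ_t` and for `φ_t` against `η_t`. Their difference is the symmetry of `∇·(D²∇)`.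
    linear_combination (c * g) * b1 - b * b2 + b * b3
  · exact (integrableOn_potentialDensity hD (h.memLp_sq hΩ hD hD' hDD' hs)).2

omit [IsFiniteMeasure (volume.restrict Ω)] in
/-- The gradient of the potential solves the original Bona–Smith system. -/
theorem IsPotentialSolution.isVelocitySolution (hΩ : IsOpen Ω) (hT : 0 < T)
    (h : IsPotentialSolution Ω D g b c T η₀ φ₀ η φ) :
    IsVelocitySolution Ω D g b c T η₀ φ₀.grad η (fun t => (φ t).grad) := by
  have hder : ∀ t ∈ Icc 0 T, derivWithin (fun t => (φ t).grad) (Icc 0 T) t =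
      (derivWithin φ (Icc 0 T) t).grad := fun t ht =>
    HasDerivWithinAt.derivWithin (((H2.gradL (Ω := Ω)).hasFDerivAt).comp_hasDerivWithinAt t
      (hasDerivWithinAt_derivWithin h.regφ ht)) (uniqueDiffOn_Icc hT t ht)
  refine ⟨h.regη, (H2.gradL (Ω := Ω)).contDiff.comp_contDiffOn h.regφ, h.mass, fun t ht => ?_, h.initη,
    congrArg H2.grad h.initφ, h.bcη, h.bcφ⟩
  obtain ⟨m, n, hm, hn, hmn⟩ := h.momentum t ht
  set v := derivWithin φ (Icc 0 T) t with hv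
  have hk : ∀ i, HasWeakPartial Ω i (fun x => ∑ j, H2.dL j (φ t) x ^ 2)
      (fun x => ∑ j, 2 * H2.dL j (φ t) x * H2.ddL j i (φ t) x) := fun i =>
    HasWeakPartial.sum_fun _ fun j => ((φ t).hasWeakPartial_dL j i).sq hΩ (Lp.memLp _) (Lp.memLp _)
  -- The gradient of `cg m + b n` need not come from regularity of `m` and `n`: the momentum
  -- equation equates this sum with `φ_t + gη + ½|∇φ|²`, whose weak gradient is known term by term.
  refine ⟨m, n, fun i x => ∑ j, 2 * H2.dL j (φ t) x * H2.ddL j i (φ t) x,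
    fun i x => H2.dL i v x + g * H2.dL i (η t) x +
      1 / 2 * ∑ j, 2 * H2.dL j (φ t) x * H2.ddL j i (φ t) x, hm, ?_, fun i => ⟨hk i, ?_, ?_⟩⟩
  · simp only [hder t ht]
    exact hn
  · refine (((v.hasWeakPartial_fnL i).add_fun (((η t).hasWeakPartial_fnL i).const_mul g)).add_fun
      ((hk i).const_mul (1 / 2))).congr_ae ?_ (ae_eq_refl _)
    filter_upwards [hmn] with x hx
    have hx' : H2.fnL v x + g * H2.fnL (η t) x + 1 / 2 * ∑ i, H2.dL i (φ t) x ^ 2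
      - c * g * m x - b * n x = 0 := hx
    linarith
  · refine Eventually.of_forall fun x => ?_
    simp only [hder t ht]
    change H2.dL i v x + g * H2.dL i (η t) x + _ - _ = 0
    ring

end BonaSmith

theorem mainTheorem5 (Ω : Set BonaSmith.Plane) (hΩ : BonaSmith.IsC11 Ω)
    (hΩb : Bornology.IsBounded Ω) (D : BonaSmith.Plane → ℝ) (hD : BonaSmith.MemW2Inf Ω D)
    (g b c : ℝ) (hg : 0 < g) (hb : 0 < b) (hc : 0 ≤ c) (T : ℝ) (hT : 0 < T)
    (η₀ φ₀ : BonaSmith.H2 Ω) (η φ : ℝ → BonaSmith.H2 Ω)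
    (hsol : BonaSmith.IsPotentialSolution Ω D g b c T η₀ φ₀ η φ) :
    -- the energy of the potential formulation is finite and conserved
    (∀ t ∈ Set.Icc 0 T,
      MeasureTheory.IntegrableOn (BonaSmith.potentialDensity D g c (η t) (φ t)) Ω ∧
      HasDerivWithinAt (fun s => BonaSmith.potentialEnergy D g c (η s) (φ s)) 0
        (Set.Icc 0 T) t) ∧
    -- `(η, ∇φ)` solves the original system, and the law is the conservation of its energy
    BonaSmith.IsVelocitySolution Ω D g b c T η₀ φ₀.grad η (fun t => (φ t).grad) ∧
    (∀ t ∈ Set.Icc 0 T,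
      BonaSmith.velocityEnergy D g c (η t) (φ t).grad =
        BonaSmith.potentialEnergy D g c (η t) (φ t)) ∧
    ∀ t ∈ Set.Icc 0 T,
      HasDerivWithinAt (fun s => BonaSmith.velocityEnergy D g c (η s) (φ s).grad) 0
        (Set.Icc 0 T) t := by
  obtain ⟨hDtop, D', -, hD', -⟩ := hD
  have hfin : MeasureTheory.IsFiniteMeasure (MeasureTheory.volume.restrict Ω) :=
    ⟨by simpa using hΩb.measure_lt_top⟩
  have hDb := fun i => (hD' i).1
  have hDD' := fun i => (hD' i).2
  have hderiv := fun t (ht : t ∈ Set.Icc 0 T) =>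
    hsol.hasDerivWithinAt_potentialEnergy hΩ.1 hDtop hDb hDD' hT ht
  -- The two energies agree by `rfl`, since the functions underlying `(φ t).grad` are the stored
  -- partial derivatives of `φ t`.
  exact ⟨fun t ht => ⟨(BonaSmith.integrableOn_potentialDensity hDtop
    (hsol.memLp_sq hΩ.1 hDtop hDb hDD' ht)).1, hderiv t ht⟩,
    hsol.isVelocitySolution hΩ.1 hT, fun t _ => rfl, hderiv⟩
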